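/- **Conventions.** A digraph $X$ consists of a set $X_0$ of vertices and a set $A(X)\subseteq X_0\times X_0$ of arrows $(x,y)$ with $x\neq y$; put $X_1=A(X)\cup\{(x,x)\mid x\in X_0\}$. A morphism $f:X\to Y$ is a map $X_0\to Y_0$ sending $X_1$ into $Y_1$. A digraph is connected if its underlying undirected graph is. Let $\mathsf{dist}(x,y)\in\{0,1,\dots,\infty\}$ be the least $n$ for which there are $x=x_0,\dots,x_n=y$ with all $(x_i,x_{i+1})\in X_1$. For $n\ge 1$ let $D_n(X)$ be the digraph with the same vertices and $D_n(X)_1=\{(x,y)\mid \mathsf{dist}(x,y)\le n\}$. Fix an integer $l\ge 1$. A morphism $p:E\to X$ is a $1$-covering if for every $e\in E_0$ and every $(p(e),y)\in X_1$ (resp. $(y,p(e))\in X_1$) there is exactly one $e'\in p^{-1}(y)$ with $(e,e')\in E_1$ (resp. $(e',e)\in E_1$). It is an $l$-covering if $D_n(p):D_n(E)\to D_n(X)$ is a $1$-covering for all $1\le n\le l$. Let $\mathscr N^l(X)$ be the simplicial set whose $n$-simplices are the sequences $(x_0,\dots,x_n)$ of vertices with $\sum_i\mathsf{dist}(x_i,x_{i+1})\le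 l$, with faces deleting and degeneracies repeating a vertex. The $l$-fundamental groupoid $\Pi^l(X)$ is the fundamental groupoid of $\mathscr N^l(X)$: the groupoid generated by its $1$-simplices, in which degenerate $1$-simplices are identities, with one relation for each $2$-simplex $z$, namely that $d_2z$ followed by $d_0z$ equals $d_1z$. For a pointed digraph $X=(X,x_0)$ let $\pi_1^l(X)$ be the group of endomorphisms of $x_0$ in $\Pi^l(X)$, with composition as product ($\gamma\delta$ is $\delta$ followed by $\gamma$). A pointed morphism $p:E\to X$ induces a homomorphism $p_*:\pi_1^l(E)\to\pi_1^l(X)$. Let $\mathsf{Cov}^{\mathsf{conn}}_{*,l}(X)$ be the full subcategory of the category of pointed digraphs over $X$ on those $p:E\to X$ that are $l$-coverings with $E$ connected. For a group $G$ let $\mathsf{Sub}(G)$ be the poset of subgroups of $G$ ordered by inclusion, regarded as a category. For an $l$-covering $p$ and a pair $(x,y)$ with $\mathsf{dist}(x,y)\le l$, lifting gives a bijection $p^{-1}(x)\to p^{-1}(y)$, $e\mapsto e'$, where $e'$ is the unique vertex of $p^{-1}(y)$ with $\mathsf{dist}(e,e')\le l$; these bijections define a functor from $\Pi^l(X)$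 to sets and bijections, and $p^{-1}(x_0)$ is a right $\pi_1^l(X)$-set in which $\gamma$ acts by the inverse of the bijection given by $\gamma$. For a subgroup $H\le G$, $G/H$ denotes the right $G$-set of cosets $Hg$. **Theorem.** Let $l\ge 1$ and let $X=(X,x_0)$ be a connected pointed digraph. Then there is an equivalence of categories $$\mathsf{Cov}^{\mathsf{conn}}_{*,l}(X)\simeq \mathsf{Sub}(\pi_1^l(X))$$ that sends a connected pointed $l$-covering $p:E\to X$ to the image of $p_*:\pi_1^l(E)\to\pi_1^l(X)$. Moreover, for every connected pointed $l$-covering $p:E\to X$ the homomorphism $p_*$ is injective and there is an isomorphism $p^{-1}(x_0)\cong \pi_1^l(X)/p_*(\pi_1^l(E))$ of $\pi_1^l(X)$-sets. -/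

import Mathlib

open CategoryTheory

universe u

namespace LCover

noncomputable section

/-! ### Digraphs, paths and distance -/

/-- A digraph: a set of vertices and a set of arrows `A(X)` without loops. -/
structure Digr where
  /-- the vertices -/
  V : Type u
  /-- the arrows -/
  graph : Digraph V
  loopless : ∀ x, ¬ graph.Adj x x

namespace Digr

/-- `(x, y) ∈ X₁ = A(X) ∪ Δ(X₀)`. -/
def E1 (X : Digr.{u}) (x y : X.V) : Prop := x = y ∨ X.graph.Adj x y

theorem E1.refl (X : Digr.{u}) (x : X.V) : X.E1 x x := Or.inl rfl

/-- A digraph is connected if its underlying undirected graph is. -/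
def Connected (X : Digr.{u}) : Prop := X.graph.toSimpleGraphInclusive.Connected

/-- A morphism of digraphs: a map of vertices sending `X₁` to `Y₁`. -/
@[ext]
structure Hom (X Y : Digr.{u}) where
  toFun : X.V → Y.V
  map_E1 : ∀ {x y : X.V}, X.E1 x y → Y.E1 (toFun x) (toFun y)

instance : Category Digr.{u} where
  Hom := Hom
  id X := ⟨fun x => x, fun h => h⟩
  comp f g := ⟨fun x => g.toFun (f.toFun x), fun h => g.map_E1 (f.map_E1 h)⟩

/-- An `n`-path is a sequence `(x₀, …, xₙ)` with `(xᵢ, xᵢ₊₁) ∈ X₁`; here `n` is `length`. -/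
abbrev Path (X : Digr.{u}) := RelSeries {q : X.V × X.V | X.E1 q.1 q.2}

/-- The minimal `n` such that there is an `n`-path from `x` to `y`, and `⊤` if there is none. -/
def dist (X : Digr.{u}) (x y : X.V) : ℕ∞ :=
  ⨅ p : {p : X.Path // p.head = x ∧ p.last = y}, (p.1.length : ℕ∞)

theorem dist_le_of_path (X : Digr.{u}) (p : X.Path) : X.dist p.head p.last ≤ p.length :=
  iInf_le (fun p' : {p' : X.Path // p'.head = p.head ∧ p'.last = p.last} =>
    (p'.1.length : ℕ∞)) ⟨p, rfl, rfl⟩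

theorem exists_path (X : Digr.{u}) {x y : X.V} (h : X.dist x y < ⊤) :
    ∃ p : X.Path, p.head = x ∧ p.last = y ∧ (p.length : ℕ∞) = X.dist x y := by
  have hne : Nonempty {p : X.Path // p.head = x ∧ p.last = y} := by
    by_contra hcon
    rw [not_nonempty_iff] at hcon
    rw [dist, iInf_of_empty] at h
    exact lt_irrefl _ h
  obtain ⟨p, hp⟩ := ENat.exists_eq_iInf
    (fun p : {p : X.Path // p.head = x ∧ p.last = y} => (p.1.length : ℕ∞))
  exact ⟨p.1, p.2.1, p.2.2, hp⟩

@[simp] theorem dist_self (X : Digr.{u}) (x : X.V) : X.dist x x = 0 := by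
  have := X.dist_le_of_path (RelSeries.singleton _ x)
  simpa using this

theorem eq_of_dist_eq_zero (X : Digr.{u}) {x y : X.V} (h : X.dist x y = 0) : x = y := by
  obtain ⟨p, h1, h2, h3⟩ := X.exists_path (x := x) (y := y) (by simp [h])
  have h0 : p.length = 0 := by rw [h] at h3; exact_mod_cast h3
  rw [← h1, ← h2]
  simp only [RelSeries.head, RelSeries.last]
  congr 1
  ext
  simp [h0]

theorem dist_triangle (X : Digr.{u}) (x y z : X.V) :
    X.dist x z ≤ X.dist x y + X.dist y z := by
  rcases eq_or_ne (X.dist x y) ⊤ with h1 | h1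
  · simp [h1]
  rcases eq_or_ne (X.dist y z) ⊤ with h2 | h2
  · simp [h2]
  obtain ⟨p, hp1, hp2, hp3⟩ := X.exists_path (lt_top_iff_ne_top.2 h1)
  obtain ⟨q, hq1, hq2, hq3⟩ := X.exists_path (lt_top_iff_ne_top.2 h2)
  have := X.dist_le_of_path (p.smash q (hp2.trans hq1.symm))
  rw [RelSeries.head_smash, RelSeries.last_smash, hp1, hq2] at this
  rw [← hp3, ← hq3]
  simpa using this

theorem dist_map_le {X Y : Digr.{u}} (f : X ⟶ Y) (x y : X.V) :
    Y.dist (f.toFun x) (f.toFun y) ≤ X.dist x y := by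
  refine le_iInf fun p => ?_
  obtain ⟨p, rfl, rfl⟩ := p
  exact Y.dist_le_of_path (p.map ⟨f.toFun, fun h => f.map_E1 h⟩)

/-- The digraph `Dₙ(X)`, with the same vertices and `Dₙ(X)₁ = {(x, y) | dist x y ≤ n}`. -/
def D (n : ℕ) (X : Digr.{u}) : Digr.{u} where
  V := X.V
  graph := ⟨fun x y => x ≠ y ∧ X.dist x y ≤ n⟩
  loopless _ h := h.1 rfl

theorem D_E1 (n : ℕ) (X : Digr.{u}) (x y : X.V) : (D n X).E1 x y ↔ X.dist x y ≤ n := by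
  constructor
  · rintro (h | h)
    · change x = y at h
      simp [h]
    · exact h.2
  · intro h
    by_cases hxy : x = y
    · exact Or.inl hxy
    · exact Or.inr ⟨hxy, h⟩

/-- The functor `Dₙ` on morphisms. -/
def DMap (n : ℕ) {X Y : Digr.{u}} (f : X ⟶ Y) : D n X ⟶ D n Y where
  toFun := f.toFun
  map_E1 {x y} h := (D_E1 n Y _ _).2 ((dist_map_le f x y).trans ((D_E1 n X x y).1 h))

/-! ### Coverings -/

/-- The quiver `Q(X)` with vertices `X₀` and arrows `X₁`. -/
instance (X : Digr.{u}) : Quiver.{0} X.V := ⟨fun x y => PLift (X.E1 x y)⟩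

/-- The morphism of quivers `Q(f)`. -/
def Hom.toQuiver {X Y : Digr.{u}} (f : X ⟶ Y) : X.V ⥤q Y.V where
  obj := f.toFun
  map e := ⟨f.map_E1 e.down⟩

/-- `p` is a `1`-covering if `Q(p)` is a covering of quivers. -/
def IsOneCovering {E X : Digr.{u}} (p : E ⟶ X) : Prop := (Hom.toQuiver p).IsCovering

/-- `p` is an `l`-covering if `Dₙ(p)` is a `1`-covering for all `1 ≤ n ≤ l`. -/
def IsCovering (l : ℕ) {E X : Digr.{u}} (p : E ⟶ X) : Prop :=
  ∀ n, 1 ≤ n → n ≤ l → IsOneCovering (DMap n p)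

theorem IsOneCovering.existsUnique_head {E X : Digr.{u}} {p : E ⟶ X} (h : IsOneCovering p)
    (e : E.V) (x : X.V) (hx : X.E1 (p.toFun e) x) :
    ∃! e', p.toFun e' = x ∧ E.E1 e e' := by
  obtain ⟨⟨e', a⟩, ha⟩ := (h.star_bijective e).2 ⟨x, ⟨hx⟩⟩
  refine ⟨e', ⟨congrArg Sigma.fst ha, a.down⟩, ?_⟩
  rintro e'' ⟨rfl, h2⟩
  have : (⟨e'', ⟨h2⟩⟩ : Quiver.Star e) = ⟨e', a⟩ := (h.star_bijective e).1 (by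
    rw [ha]; rfl)
  exact congrArg Sigma.fst this

theorem IsOneCovering.existsUnique_tail {E X : Digr.{u}} {p : E ⟶ X} (h : IsOneCovering p)
    (e : E.V) (x : X.V) (hx : X.E1 x (p.toFun e)) :
    ∃! e', p.toFun e' = x ∧ E.E1 e' e := by
  obtain ⟨⟨e', a⟩, ha⟩ := (h.costar_bijective e).2 ⟨x, ⟨hx⟩⟩
  refine ⟨e', ⟨congrArg Sigma.fst ha, a.down⟩, ?_⟩
  rintro e'' ⟨rfl, h2⟩
  have : (⟨e'', ⟨h2⟩⟩ : Quiver.Costar e) = ⟨e', a⟩ := (h.costar_bijective e).1 (by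
    rw [ha]; rfl)
  exact congrArg Sigma.fst this

theorem IsCovering.existsUnique_head {l : ℕ} {E X : Digr.{u}} {p : E ⟶ X}
    (h : IsCovering l p) (e : E.V) (x : X.V) (hx : X.dist (p.toFun e) x ≤ l) :
    ∃! e', p.toFun e' = x ∧ E.dist e e' ≤ l := by
  rcases Nat.eq_zero_or_pos l with rfl | hl
  · refine ⟨e, ⟨X.eq_of_dist_eq_zero (by simpa using hx), by simp⟩, fun e' h' => ?_⟩
    exact (E.eq_of_dist_eq_zero (by simpa using h'.2)).symm
  · have := (h l hl le_rfl).existsUnique_head e x ((D_E1 l X _ _).2 hx)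
    obtain ⟨e', ⟨h1, h2⟩, h3⟩ := this
    exact ⟨e', ⟨h1, (D_E1 l E _ _).1 h2⟩, fun y hy => h3 y ⟨hy.1, (D_E1 l E _ _).2 hy.2⟩⟩

theorem IsCovering.existsUnique_tail {l : ℕ} {E X : Digr.{u}} {p : E ⟶ X}
    (h : IsCovering l p) (e : E.V) (x : X.V) (hx : X.dist x (p.toFun e) ≤ l) :
    ∃! e', p.toFun e' = x ∧ E.dist e' e ≤ l := by
  rcases Nat.eq_zero_or_pos l with rfl | hl
  · refine ⟨e, ⟨(X.eq_of_dist_eq_zero (by simpa using hx)).symm, by simp⟩, fun e' h' => ?_⟩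
    exact E.eq_of_dist_eq_zero (by simpa using h'.2)
  · have := (h l hl le_rfl).existsUnique_tail e x ((D_E1 l X _ _).2 hx)
    obtain ⟨e', ⟨h1, h2⟩, h3⟩ := this
    exact ⟨e', ⟨h1, (D_E1 l E _ _).1 h2⟩, fun y hy => h3 y ⟨hy.1, (D_E1 l E _ _).2 hy.2⟩⟩

theorem IsCovering.of_le {k l : ℕ} {E X : Digr.{u}} {p : E ⟶ X}
    (h : IsCovering l p) (hk : k ≤ l) : IsCovering k p :=
  fun n h1 h2 => h n h1 (h2.trans hk)

theorem IsCovering.dist_eq {l : ℕ} {E X : Digr.{u}} {p : E ⟶ X}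
    (h : IsCovering l p) {e e' : E.V} (he : E.dist e e' ≤ l) :
    E.dist e e' = X.dist (p.toFun e) (p.toFun e') := by
  refine le_antisymm ?_ (dist_map_le p e e')
  have hle := (dist_map_le p e e').trans he
  obtain ⟨k, hk⟩ := ENat.ne_top_iff_exists.1 (ne_top_of_le_ne_top (ENat.natCast_ne_top l) hle)
  have hkl : k ≤ l := by rw [← hk] at hle; exact_mod_cast hle
  obtain ⟨e'', ⟨h1, h2⟩, -⟩ :=
    (h.of_le hkl).existsUnique_head e (p.toFun e') (by rw [hk])
  have : e'' = e' := (h.existsUnique_head e (p.toFun e') hle).unique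
    ⟨h1, h2.trans (by exact_mod_cast hkl)⟩ ⟨rfl, he⟩
  rw [← hk, ← this]
  exact h2

/-! ### The filtered nerve -/

/-- The length of a sequence of vertices. -/
def seqLength (X : Digr.{u}) {n : ℕ} (s : Fin (n + 1) → X.V) : ℕ∞ :=
  ∑ i : Fin n, X.dist (s i.castSucc) (s i.succ)

/-- A sequence `(x₀, …, xₙ)` is accessible if `dist xᵢ xᵢ₊₁ < ∞` for all `i`. -/
def Accessible (X : Digr.{u}) {n : ℕ} (s : Fin (n + 1) → X.V) : Prop :=
  ∀ i : Fin n, X.dist (s i.castSucc) (s i.succ) < ⊤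

theorem dist_nat_le_sum (X : Digr.{u}) (t : ℕ → X.V) {a b : ℕ} (hab : a ≤ b) :
    X.dist (t a) (t b) ≤ ∑ k ∈ Finset.Ico a b, X.dist (t k) (t (k + 1)) := by
  induction b, hab using Nat.le_induction with
  | base => simp
  | succ b hab ih =>
    rw [Finset.sum_Ico_succ_top hab]
    exact (X.dist_triangle _ (t b) _).trans (add_le_add ih le_rfl)

theorem sum_comp_le (X : Digr.{u}) (t : ℕ → X.V) (g : ℕ → ℕ) (hg : Monotone g) (m : ℕ) :
    ∑ j ∈ Finset.range m, X.dist (t (g j)) (t (g (j + 1))) ≤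
      ∑ k ∈ Finset.Ico (g 0) (g m), X.dist (t k) (t (k + 1)) := by
  induction m with
  | zero => simp
  | succ m ih =>
    rw [Finset.sum_range_succ, ← Finset.sum_Ico_consecutive _ (hg (Nat.zero_le m))
      (hg (Nat.le_succ m))]
    exact add_le_add ih (X.dist_nat_le_sum t (hg (Nat.le_succ m)))

theorem seqLength_comp_le (X : Digr.{u}) {m n : ℕ} (s : Fin (n + 1) → X.V)
    (g : Fin (m + 1) →o Fin (n + 1)) : X.seqLength (fun i => s (g i)) ≤ X.seqLength s := by
  let t : ℕ → X.V := fun k => s ⟨min k n, by omega⟩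
  let g' : ℕ → ℕ := fun k => g ⟨min k m, by omega⟩
  have hg' : Monotone g' := fun a b hab => by
    apply g.monotone
    simp only [Fin.mk_le_mk]
    omega
  have h1 : X.seqLength (fun i => s (g i)) =
      ∑ j ∈ Finset.range m, X.dist (t (g' j)) (t (g' (j + 1))) := by
    rw [seqLength, Finset.sum_range]
    refine Finset.sum_congr rfl fun i _ => ?_
    congr 1
    · simp only [t, g']
      congr 1
      ext
      have hi : (⟨min (i : ℕ) m, by omega⟩ : Fin (m + 1)) = i.castSucc := by
        ext; simp only [Fin.val_castSucc]; omega
      simp only [hi]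
      have := (g i.castSucc).2
      omega
    · simp only [t, g']
      congr 1
      ext
      have hi : (⟨min ((i : ℕ) + 1) m, by omega⟩ : Fin (m + 1)) = i.succ := by
        ext; simp only [Fin.val_succ]; omega
      simp only [hi]
      have := (g i.succ).2
      omega
  have h2 : X.seqLength s = ∑ k ∈ Finset.range n, X.dist (t k) (t (k + 1)) := by
    rw [seqLength, Finset.sum_range]
    refine Finset.sum_congr rfl fun i _ => ?_
    congr 1
    · simp only [t]
      congr 1
      ext
      simp only [Fin.val_castSucc]
      omega
    · simp only [t]
      congr 1
      ext
      simp only [Fin.val_succ]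
      omega
  rw [h1, h2]
  refine (X.sum_comp_le t g' hg' m).trans (Finset.sum_le_sum_of_subset ?_)
  intro k hk
  have := (g ⟨min m m, by omega⟩).2
  simp only [Finset.mem_Ico, Finset.mem_range, g'] at hk ⊢
  omega

theorem accessible_iff (X : Digr.{u}) {n : ℕ} (s : Fin (n + 1) → X.V) :
    X.Accessible s ↔ X.seqLength s < ⊤ := by
  simp [Accessible, seqLength]

/-- The nerve: its `n`-simplices are the accessible sequences `(x₀, …, xₙ)`, and a monotone map
`g : [m] → [n]` acts by `(x₀, …, xₙ) ↦ (x_{g 0}, …, x_{g m})`. -/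
def nerve (X : Digr.{u}) : SSet.{u} where
  obj n := {s : Fin (n.unop.len + 1) → X.V // X.Accessible s}
  map g := ↾fun s => ⟨fun i => s.1 (g.unop.toOrderHom i), (X.accessible_iff _).2
    ((X.seqLength_comp_le s.1 g.unop.toOrderHom).trans_lt ((X.accessible_iff _).1 s.2))⟩

/-- The simplicial subset of the nerve of accessible sequences of length at most `l`. -/
def filteredNerve (l : ℕ) (X : Digr.{u}) : X.nerve.Subcomplex where
  obj _ := {s | X.seqLength s.1 ≤ l}
  map g s hs := (X.seqLength_comp_le s.1 g.unop.toOrderHom).trans hs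

theorem seqLength_map_le {X Y : Digr.{u}} (f : X ⟶ Y) {n : ℕ} (s : Fin (n + 1) → X.V) :
    Y.seqLength (fun i => f.toFun (s i)) ≤ X.seqLength s :=
  Finset.sum_le_sum fun _ _ => dist_map_le f _ _

/-- The map of filtered nerves induced by a morphism of digraphs, applied termwise. -/
def filteredNerveMap (l : ℕ) {X Y : Digr.{u}} (f : X ⟶ Y) :
    (filteredNerve l X).toSSet ⟶ (filteredNerve l Y).toSSet where
  app _ := ↾fun s => ⟨⟨fun i => f.toFun (s.1.1 i), (Y.accessible_iff _).2
    ((seqLength_map_le f s.1.1).trans_lt ((X.accessible_iff _).1 s.1.2))⟩,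
    (seqLength_map_le f s.1.1).trans s.2⟩

end Digr

/-! ### The fundamental groupoid of a simplicial set -/

open Simplicial in
/-- The set `S₀` of vertices of a simplicial set. -/
abbrev Verts (S : SSet.{u}) : Type u := S _⦋0⦌

namespace SPi

/-- The quiver `(S₀, S₁, d₀, d₁, s₀)` of a simplicial set. -/
abbrev Q (S : SSet.{u}) := SSet.OneTruncation₂ ((SSet.truncation 2).obj S)

/-- The free groupoid on this quiver: all morphisms of the free category are inverted. -/
abbrev Free (S : SSet.{u}) := FreeGroupoid (Cat.FreeRefl (Q S))

/-- A vertex, as an object of the free groupoid. -/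
abbrev freeMk {S : SSet.{u}} (x : Verts S) : Free S :=
  FreeGroupoid.mk (Cat.FreeRefl.mk (V := Q S) x)

/-- A `1`-simplex, as a morphism of the free groupoid. -/
abbrev freeHom {S : SSet.{u}} {x y : Verts S} (e : SSet.Edge x y) : freeMk x ⟶ freeMk y :=
  FreeGroupoid.homMk (Cat.FreeRefl.homMk (V := Q S) e.toTruncated)

/-- The relations `d₂ z · d₀ z = d₁ z` for the `2`-simplices `z`. -/
inductive Rel (S : SSet.{u}) : HomRel (Free S)
  | of_simplex {x₀ x₁ x₂ : Verts S} {e₀₁ : SSet.Edge x₀ x₁} {e₁₂ : SSet.Edge x₁ x₂}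
      {e₀₂ : SSet.Edge x₀ x₂} (z : SSet.Edge.CompStruct e₀₁ e₁₂ e₀₂) :
      Rel S (freeHom e₀₁ ≫ freeHom e₁₂) (freeHom e₀₂)

end SPi

/-- The fundamental groupoid of a simplicial set. -/
def FundGrpd (S : SSet.{u}) := CategoryTheory.Quotient (SPi.Rel S)

namespace FundGrpd

instance (S : SSet.{u}) : Groupoid (FundGrpd S) := CategoryTheory.Quotient.groupoid (SPi.Rel S)

/-- The projection from the free groupoid. -/
def proj (S : SSet.{u}) : SPi.Free S ⥤ FundGrpd S := CategoryTheory.Quotient.functor (SPi.Rel S)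

/-- A vertex, as an object of the fundamental groupoid. -/
def mk {S : SSet.{u}} (x : Verts S) : FundGrpd S := (proj S).obj (SPi.freeMk x)

/-- A `1`-simplex, as a morphism of the fundamental groupoid. -/
def homMk {S : SSet.{u}} {x y : Verts S} (e : SSet.Edge x y) : mk x ⟶ mk y :=
  (proj S).map (SPi.freeHom e)

theorem homMk_comp {S : SSet.{u}} {x₀ x₁ x₂ : Verts S} {e₀₁ : SSet.Edge x₀ x₁}
    {e₁₂ : SSet.Edge x₁ x₂} {e₀₂ : SSet.Edge x₀ x₂} (z : SSet.Edge.CompStruct e₀₁ e₁₂ e₀₂) :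
    homMk e₀₁ ≫ homMk e₁₂ = homMk e₀₂ :=
  ((proj S).map_comp _ _).symm.trans (CategoryTheory.Quotient.sound _ (SPi.Rel.of_simplex z))

theorem homMk_id {S : SSet.{u}} (x : Verts S) : homMk (SSet.Edge.id x) = 𝟙 (mk x) :=
  (cancel_epi (homMk (SSet.Edge.id x))).1
    ((homMk_comp (SSet.Edge.CompStruct.idCompId x)).trans (Category.comp_id _).symm)

/-- The universal property of the fundamental groupoid. -/
def lift {S : SSet.{u}} {G : Type*} [Groupoid G] (obj : Verts S → G)
    (map : ∀ {x y : Verts S}, SSet.Edge x y → (obj x ⟶ obj y))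
    (map_id : ∀ x : Verts S, map (SSet.Edge.id x) = 𝟙 (obj x))
    (map_comp : ∀ {x₀ x₁ x₂ : Verts S} {e₀₁ : SSet.Edge x₀ x₁} {e₁₂ : SSet.Edge x₁ x₂}
      {e₀₂ : SSet.Edge x₀ x₂}, SSet.Edge.CompStruct e₀₁ e₁₂ e₀₂ →
      map e₀₁ ≫ map e₁₂ = map e₀₂) : FundGrpd S ⥤ G :=
  CategoryTheory.Quotient.lift _ (FreeGroupoid.lift (Cat.FreeRefl.lift' (V := SPi.Q S) (fun x => obj x)
    (fun e => map (SSet.Edge.ofTruncated e)) (fun x => map_id x))) (by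
      rintro _ _ _ _ ⟨z⟩
      rw [Functor.map_comp, SPi.freeHom, SPi.freeHom, SPi.freeHom, FreeGroupoid.lift_map_homMk,
        FreeGroupoid.lift_map_homMk, FreeGroupoid.lift_map_homMk]
      have h {x y : Verts S} (e : SSet.Edge x y) := Cat.FreeRefl.lift'_map (V := SPi.Q S)
        (fun x => obj x) (fun e => map (SSet.Edge.ofTruncated e)) (fun x => map_id x) e.toTruncated
      exact (congrArg₂ (· ≫ ·) (h _) (h _)).trans ((map_comp z).trans (h _).symm))

/-- The functor of fundamental groupoids induced by a map of simplicial sets. -/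
def map {S T : SSet.{u}} (f : S ⟶ T) : FundGrpd S ⥤ FundGrpd T :=
  lift (fun x => mk (f.app _ x)) (fun e => homMk (e.map f))
    (fun x => by
      rw [SSet.Edge.map_id]
      exact homMk_id _)
    (fun z => homMk_comp (z.map f))

end FundGrpd

/-! ### Pointed digraphs and their fundamental groups -/

/-- A pointed digraph. -/
structure PDigr where
  /-- the digraph -/
  X : Digr.{u}
  /-- the basepoint -/
  pt : X.V

namespace PDigr

/-- A morphism of pointed digraphs. -/
@[ext]
structure Hom (X Y : PDigr.{u}) where
  hom : X.X ⟶ Y.X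
  map_pt : hom.toFun X.pt = Y.pt

instance : Category PDigr.{u} where
  Hom := Hom
  id X := ⟨𝟙 X.X, rfl⟩
  comp f g := ⟨f.hom ≫ g.hom, (congrArg g.hom.toFun f.map_pt).trans g.map_pt⟩

end PDigr

/-- A vertex of a digraph as a `0`-simplex of the filtered nerve. -/
def vert (l : ℕ) {X : Digr.{u}} (x : X.V) : Verts (Digr.filteredNerve l X).toSSet :=
  ⟨⟨fun _ => x, fun i => i.elim0⟩, by
    change X.seqLength (n := 0) _ ≤ _
    simp [Digr.seqLength]⟩

/-- The `l`-fundamental groupoid of a digraph. -/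
abbrev LPi (l : ℕ) (X : Digr.{u}) := FundGrpd (Digr.filteredNerve l X).toSSet

/-- The functor of `l`-fundamental groupoids induced by a morphism of digraphs. -/
abbrev lPiMap (l : ℕ) {X Y : Digr.{u}} (f : X ⟶ Y) : LPi l X ⥤ LPi l Y :=
  FundGrpd.map (Digr.filteredNerveMap l f)

/-- The `l`-fundamental group: the automorphism group of the basepoint in the `l`-fundamental
groupoid. The product is the composition: `γ * δ` is `δ` followed by `γ`. -/
abbrev pi1 (l : ℕ) (X : PDigr.{u}) := End (FundGrpd.mk (vert l X.pt) : LPi l X.X)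

theorem lPiMap_pt (l : ℕ) {E X : PDigr.{u}} (p : E ⟶ X) :
    (lPiMap l p.hom).obj (FundGrpd.mk (vert l E.pt)) = FundGrpd.mk (vert l X.pt) :=
  congrArg (fun x => (FundGrpd.mk (vert l x) : LPi l X.X)) p.map_pt

/-- The homomorphism `p_*` induced by a pointed morphism; the second factor only identifies
the image of the basepoint with the basepoint. -/
def pi1Map (l : ℕ) {E X : PDigr.{u}} (p : E ⟶ X) : pi1 l E →* pi1 l X :=
  (eqToIso (lPiMap_pt l p)).conj.toMonoidHom.comp ((lPiMap l p.hom).mapEnd _)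

/-! ### The fibre functor -/

section Monodromy

variable {l : ℕ} {E X : Digr.{u}} {p : E ⟶ X}

/-- Lifting of arrows of `D_l(X)`: a vertex `e` over the tail `x` is sent to the head of the
unique lift that starts at `e`. -/
def transport (h : Digr.IsCovering l p) {x y : X.V} (hxy : X.dist x y ≤ l) :
    {e : E.V // p.toFun e = x} ≃ {e : E.V // p.toFun e = y} where
  toFun e := ⟨_, (h.existsUnique_head e.1 y (by rw [e.2]; exact hxy)).choose_spec.1.1⟩
  invFun e := ⟨_, (h.existsUnique_tail e.1 x (by rw [e.2]; exact hxy)).choose_spec.1.1⟩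
  left_inv e := by
    have h1 := (h.existsUnique_head e.1 y (by rw [e.2]; exact hxy)).choose_spec.1
    ext
    exact (h.existsUnique_tail _ x (by rw [h1.1]; exact hxy)).unique
      (h.existsUnique_tail _ x (by rw [h1.1]; exact hxy)).choose_spec.1 ⟨e.2, h1.2⟩
  right_inv e := by
    have h1 := (h.existsUnique_tail e.1 x (by rw [e.2]; exact hxy)).choose_spec.1
    ext
    exact (h.existsUnique_head _ y (by rw [h1.1]; exact hxy)).unique
      (h.existsUnique_head _ y (by rw [h1.1]; exact hxy)).choose_spec.1 ⟨e.2, h1.2⟩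

theorem transport_dist (h : Digr.IsCovering l p) {x y : X.V} (hxy : X.dist x y ≤ l)
    (e : {e : E.V // p.toFun e = x}) : E.dist e.1 (transport h hxy e).1 ≤ l :=
  (h.existsUnique_head e.1 y (by rw [e.2]; exact hxy)).choose_spec.1.2

theorem transport_eq (h : Digr.IsCovering l p) {x y : X.V} (hxy : X.dist x y ≤ l)
    (e : {e : E.V // p.toFun e = x}) (e' : {e : E.V // p.toFun e = y})
    (he : E.dist e.1 e'.1 ≤ l) : transport h hxy e = e' :=
  Subtype.ext ((h.existsUnique_head e.1 y (by rw [e.2]; exact hxy)).unique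
    ⟨(transport h hxy e).2, transport_dist h hxy e⟩ ⟨e'.2, he⟩)

/-- The vertex of a `0`-simplex. -/
def vtx (s : Verts (Digr.filteredNerve l X).toSSet) : X.V := s.1.1 0

theorem edge_src {s t : Verts (Digr.filteredNerve l X).toSSet} (e : SSet.Edge s t) :
    e.edge.1.1 0 = vtx s :=
  congrArg vtx e.src_eq

theorem edge_tgt {s t : Verts (Digr.filteredNerve l X).toSSet} (e : SSet.Edge s t) :
    e.edge.1.1 1 = vtx t :=
  congrArg vtx e.tgt_eq

theorem edge_dist {s t : Verts (Digr.filteredNerve l X).toSSet} (e : SSet.Edge s t) :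
    X.dist (vtx s) (vtx t) ≤ l := by
  have h : X.seqLength (n := 1) e.edge.1.1 ≤ l := e.edge.2
  rw [← edge_src e, ← edge_tgt e]
  simpa [Digr.seqLength] using h

theorem simplex_dist {s₀ s₁ s₂ : Verts (Digr.filteredNerve l X).toSSet} {e₀₁ : SSet.Edge s₀ s₁}
    {e₁₂ : SSet.Edge s₁ s₂} {e₀₂ : SSet.Edge s₀ s₂} (z : SSet.Edge.CompStruct e₀₁ e₁₂ e₀₂) :
    X.dist (vtx s₀) (vtx s₁) + X.dist (vtx s₁) (vtx s₂) ≤ l := by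
  have h : X.seqLength (n := 2) z.simplex.1.1 ≤ l := z.simplex.2
  have h0 : z.simplex.1.1 0 = vtx s₀ :=
    (congrArg (fun s => s.1.1 0) z.d₂).trans (edge_src e₀₁)
  have h1 : z.simplex.1.1 1 = vtx s₁ :=
    (congrArg (fun s => s.1.1 1) z.d₂).trans (edge_tgt e₀₁)
  have h2 : z.simplex.1.1 2 = vtx s₂ :=
    (congrArg (fun s => s.1.1 1) z.d₀).trans (edge_tgt e₁₂)
  rw [← h0, ← h1, ← h2]
  simpa [Digr.seqLength, Fin.sum_univ_two] using h

/-- The functor sending a vertex `x` to the fibre `p⁻¹(x)` and an arrow `(x, y)` to the bijection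
`p⁻¹(x) → p⁻¹(y)` given by lifting it. -/
def monodromy (h : Digr.IsCovering l p) : LPi l X ⥤ Core (Type u) :=
  FundGrpd.lift (fun s => ⟨{e : E.V // p.toFun e = vtx s}⟩)
    (fun e => ⟨(transport h (edge_dist e)).toIso⟩)
    (fun s => by
      ext e
      exact congrArg Subtype.val (transport_eq h (edge_dist (SSet.Edge.id s)) e e (by simp)))
    (fun {s₀ s₁ s₂ e₀₁ e₁₂ e₀₂} z => by
      ext e
      refine congrArg Subtype.val (transport_eq h (edge_dist e₀₂) e
        (transport h (edge_dist e₁₂) (transport h (edge_dist e₀₁) e)) ?_).symm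
      refine (E.dist_triangle _ (transport h (edge_dist e₀₁) e).1 _).trans ?_
      have h0 : p.toFun e.1 = vtx s₀ := e.2
      rw [h.dist_eq (transport_dist h _ _), h.dist_eq (transport_dist h _ _),
        (transport h (edge_dist e₀₁) e).2, (transport h (edge_dist e₁₂) _).2, h0]
      exact simplex_dist z)

/-- The action of a morphism `γ : a ⟶ b` of the `l`-fundamental groupoid from the fibre over `b` to
the fibre over `a`, written `e · γ`: the inverse of the bijection given by lifting `γ`, so that
`e · γ` is the vertex from which the lift of `γ` with end `e` starts. -/
def fibMap (h : Digr.IsCovering l p) {a b : LPi l X} (γ : a ⟶ b)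
    (e : ((monodromy h).obj b).of) : ((monodromy h).obj a).of :=
  ((monodromy h).map γ).iso.inv e

theorem fibMap_id (h : Digr.IsCovering l p) (a : LPi l X) (e : ((monodromy h).obj a).of) :
    fibMap h (𝟙 a) e = e := by
  rw [fibMap, CategoryTheory.Functor.map_id]
  rfl

theorem fibMap_comp (h : Digr.IsCovering l p) {a b c : LPi l X} (γ : a ⟶ b) (δ : b ⟶ c)
    (e : ((monodromy h).obj c).of) : fibMap h (γ ≫ δ) e = fibMap h γ (fibMap h δ e) := by
  rw [fibMap, CategoryTheory.Functor.map_comp]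
  rfl

end Monodromy

/-! ### The category of connected pointed coverings -/

/-- The pointed morphisms to `X` that are `l`-coverings with connected source. -/
def isConnCov (l : ℕ) (X : PDigr.{u}) : ObjectProperty (Over X) :=
  fun p => Digr.IsCovering l p.hom.hom ∧ p.left.X.Connected

/-- The category of connected pointed `l`-coverings of `X`, a full subcategory of the category
of pointed digraphs over `X`. -/
abbrev ConnCov (l : ℕ) (X : PDigr.{u}) := (isConnCov l X).FullSubcategory

namespace ConnCov

variable {l : ℕ} {X : PDigr.{u}}

/-- The total digraph of a covering. -/
abbrev total (p : ConnCov l X) : PDigr.{u} := p.obj.left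

/-- The pointed morphism underlying a covering. -/
abbrev proj (p : ConnCov l X) : p.total ⟶ X := p.obj.hom

/-- The fibre `p⁻¹(x₀)` over the basepoint. -/
def Fiber (p : ConnCov l X) : Type u := {e : p.total.X.V // p.proj.hom.toFun e = X.pt}

theorem isCovering (p : ConnCov l X) : Digr.IsCovering l p.proj.hom := p.property.1

/-- The fibre is a right set over the `l`-fundamental group through `e · γ`. -/
instance (p : ConnCov l X) : MulAction (pi1 l X)ᵐᵒᵖ p.Fiber where
  smul γ e := fibMap p.isCovering γ.unop e
  one_smul e := fibMap_id p.isCovering (FundGrpd.mk (vert l X.pt)) e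
  mul_smul γ δ e := fibMap_comp p.isCovering γ.unop δ.unop e

end ConnCov

/-! ### Cosets -/

/-- The set `G/H` for right `G`-sets: the cosets `Hg`. -/
def RightCosets {G : Type*} [Group G] (H : Subgroup G) := _root_.Quotient (QuotientGroup.rightRel H)

/-- The coset `Hg`. -/
def RightCosets.mk {G : Type*} [Group G] (H : Subgroup G) (g : G) : RightCosets H :=
  _root_.Quotient.mk (QuotientGroup.rightRel H) g

/-- The right action `Hg · k = H(gk)`. -/
instance {G : Type*} [Group G] (H : Subgroup G) : MulAction Gᵐᵒᵖ (RightCosets H) where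
  smul k := _root_.Quotient.map (fun g => g * k.unop) (fun a b hab => by
    have hab' : QuotientGroup.rightRel H a b := hab
    change QuotientGroup.rightRel H _ _
    rw [QuotientGroup.rightRel_apply] at hab' ⊢
    simpa [mul_assoc] using hab')
  one_smul q := by
    induction q using _root_.Quotient.inductionOn with
    | h g => exact congrArg (RightCosets.mk H) (mul_one g)
  mul_smul k k' q := by
    induction q using _root_.Quotient.inductionOn with
    | h g => exact congrArg (RightCosets.mk H) (mul_assoc g _ _).symm

end

end LCover

/-! Everything is read off from the action of `Π^l(X)` on the fibres of an `l`-covering `p`. This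
action exists because of `IsCovering.dist_eq`: distances of at most `l` upstairs agree with those of
the images, so a 2-simplex of the filtered nerve lifts to a 2-simplex. Since `Π^l(X)` is generated
by pairs at distance at most `l`, statements about morphisms are checked on such pairs and
propagated through composition and inversion (`LPi.induction`).

The image of `p_*` is the stabilizer of the base vertex (`mem_range_pi1Map_iff`). Morphisms of
coverings are equivariant, so they only enlarge stabilizers. Conversely, an inclusion of stabilizers
allows a morphism to be defined by moving the base vertex along images of morphisms of `Π^l(E)`
(`exists_map`), and connectedness makes it unique (`map_unique`). Hence taking images is fully
faithful. A subgroup `H` is realized by the morphisms out of `x₀` modulo `H`, with arrows lifted by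
composition. That this is an `l`-covering rests on the computation of its distances up to `l`
(`total_dist_le_iff`).

Injectivity of `p_*` uses a second representation of `Π^l(X)` (`pathRep`): over `x` sit the pairs of
a vertex `e` above `x` and a morphism from `e₀` to `e`. The image of `γ` sends `(e₀, 𝟙)` to `(e',
γ)`, so it determines `γ`. The description of the fibre is the orbit-stabilizer theorem,
transitivity coming from the connectedness of `E`. -/

namespace LCover

noncomputable section

/-! ### Induction on morphisms of fundamental groupoids. -/

namespace FundGrpd

variable {S : SSet.{u}}

/-- A property of morphisms of a free groupoid on a quiver that holds for the generators and is
closed under identities, composition and inversion holds for all morphisms. -/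
theorem quiverFree_induction {V : Type*} [Quiver V] (W : MorphismProperty (Quiver.FreeGroupoid V))
    [W.IsMultiplicative] (hinv : ∀ {a b : Quiver.FreeGroupoid V} (f : a ⟶ b), W f → W (Groupoid.inv f))
    (hof : ∀ {x y : V} (f : x ⟶ y), W ((Quiver.FreeGroupoid.of V).map f))
    {a b : Quiver.FreeGroupoid V} (f : a ⟶ b) : W f := by
  have key {a b : Quiver.Symmetrify V} (q : Quiver.Path a b) :
      W (X := ⟨a⟩) (Y := ⟨b⟩)
        ((CategoryTheory.Quotient.functor Quiver.FreeGroupoid.redStep).map q) := by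
    induction q with
    | nil => exact W.id_mem _
    | cons q g ih =>
      let g' : (⟨_⟩ : Quiver.FreeGroupoid V) ⟶ ⟨_⟩ :=
        (CategoryTheory.Quotient.functor Quiver.FreeGroupoid.redStep).map (Quiver.Hom.toPath g)
      refine W.comp_mem _ g' ih ?_
      -- A letter is either a generator or the formal inverse of one.
      rcases g with g | g
      · exact hof g
      · exact hinv _ (hof g)
  obtain ⟨a⟩ := a
  obtain ⟨b⟩ := b
  obtain ⟨f⟩ := f
  exact key f

/-- A property of morphisms of the free groupoid on a category that holds for the images of
morphisms and is closed under identities, composition and inversion holds for all morphisms. -/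
theorem free_induction {C : Type*} [Category C] (W : MorphismProperty (FreeGroupoid C))
    [W.IsMultiplicative] (hinv : ∀ {a b : FreeGroupoid C} (f : a ⟶ b), W f → W (Groupoid.inv f))
    (hof : ∀ {x y : C} (f : x ⟶ y), W (FreeGroupoid.homMk f))
    {a b : FreeGroupoid C} (f : a ⟶ b) : W f := by
  obtain ⟨a⟩ := a
  obtain ⟨b⟩ := b
  obtain ⟨f, rfl⟩ := (CategoryTheory.Quotient.functor (FreeGroupoid.homRel C)).map_surjective f
  let W' : MorphismProperty (Quiver.FreeGroupoid C) :=
    W.inverseImage (CategoryTheory.Quotient.functor (FreeGroupoid.homRel C))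
  have : W'.IsMultiplicative :=
    { id_mem := fun _ => W.id_mem _
      comp_mem := fun f g hf hg => W.comp_mem _ _ hf hg }
  exact quiverFree_induction W' (fun f hf => hinv _ hf) (fun f => hof f) f

/-- A property of morphisms of a fundamental groupoid that holds for the `1`-simplices and is
closed under identities, composition and inversion holds for all morphisms. -/
theorem hom_induction (W : MorphismProperty (FundGrpd S))
    [W.IsMultiplicative] (hinv : ∀ {a b : FundGrpd S} (f : a ⟶ b), W f → W (Groupoid.inv f))
    (hof : ∀ {x y : Verts S} (e : SSet.Edge x y), W (homMk e))
    {a b : FundGrpd S} (f : a ⟶ b) : W f := by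
  obtain ⟨a⟩ := a
  obtain ⟨b⟩ := b
  obtain ⟨f, rfl⟩ := (CategoryTheory.Quotient.functor (SPi.Rel S)).map_surjective f
  -- The layers are peeled off in turn: the relations of the 2-simplices, the formal inverses, and
  -- the free category on the 1-simplices.
  let W' : MorphismProperty (SPi.Free S) := W.inverseImage (FundGrpd.proj S)
  refine free_induction W' (fun f hf => hinv _ hf) (fun f => ?_) f
  have : W'.inverseImage (FreeGroupoid.of (Cat.FreeRefl (SPi.Q S))) = ⊤ :=
    Cat.FreeRefl.morphismProperty_eq_top (fun e => hof (SSet.Edge.ofTruncated e))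
  have h2 : W'.inverseImage (FreeGroupoid.of (Cat.FreeRefl (SPi.Q S))) f := by rw [this]; trivial
  exact h2

theorem exists_mk (a : FundGrpd S) : ∃ x : Verts S, mk x = a := ⟨a.as.as.as.as, rfl⟩

/-- None of the free and quotient constructions changes the objects, so the vertex can be read off.
-/
theorem mk_injective : Function.Injective (mk (S := S)) := fun x y h => by
  have := congrArg (fun a : FundGrpd S => (a.as.as.as.as : Verts S)) h
  exact this

theorem lift_map_homMk {G : Type*} [Groupoid G] (obj : Verts S → G)
    (map : ∀ {x y : Verts S}, SSet.Edge x y → (obj x ⟶ obj y))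
    (map_id : ∀ x : Verts S, map (SSet.Edge.id x) = 𝟙 (obj x))
    (map_comp : ∀ {x₀ x₁ x₂ : Verts S} {e₀₁ : SSet.Edge x₀ x₁} {e₁₂ : SSet.Edge x₁ x₂}
      {e₀₂ : SSet.Edge x₀ x₂}, SSet.Edge.CompStruct e₀₁ e₁₂ e₀₂ →
      map e₀₁ ≫ map e₁₂ = map e₀₂) {x y : Verts S} (e : SSet.Edge x y) :
    (lift obj map map_id map_comp).map (homMk e) = map e := by
  refine (FreeGroupoid.lift_map_homMk _ _).trans ?_
  exact Cat.FreeRefl.lift'_map (V := SPi.Q S)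
        (fun x => obj x) (fun e => map (SSet.Edge.ofTruncated e)) (fun x => map_id x) e.toTruncated

theorem map_homMk {T : SSet.{u}} (f : S ⟶ T) {x y : Verts S} (e : SSet.Edge x y) :
    (map f).map (homMk e) = homMk (e.map f) := by
  unfold map
  rw [lift_map_homMk]
  exact fun z => homMk_comp (z.map f)

end FundGrpd

/-! ### Generators and relations of the `l`-fundamental groupoid. -/

namespace LPi

variable {l : ℕ} {X : Digr.{u}}

/-- A vertex of a digraph, as an object of the `l`-fundamental groupoid. -/
abbrev ob (l : ℕ) {X : Digr.{u}} (x : X.V) : LPi l X := FundGrpd.mk (vert l x)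

theorem seqLength_one {x y : X.V} : X.seqLength (n := 1) ![x, y] = X.dist x y := by
  simp [Digr.seqLength]

theorem seqLength_two {x y z : X.V} :
    X.seqLength (n := 2) ![x, y, z] = X.dist x y + X.dist y z := by
  simp [Digr.seqLength, Fin.sum_univ_two]

/-- The simplex of the filtered nerve given by a sequence of length at most `l`. -/
def simplex {n : ℕ} (s : Fin (n + 1) → X.V) (h : X.seqLength s ≤ l) :
    (Digr.filteredNerve l X).toSSet.obj (.op (SimplexCategory.mk n)) :=
  ⟨⟨s, (X.accessible_iff s).2 (h.trans_lt (ENat.natCast_lt_top l))⟩, h⟩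

theorem vert_ext {s t : Verts (Digr.filteredNerve l X).toSSet} (h : vtx s = vtx t) : s = t := by
  apply Subtype.ext
  apply Subtype.ext
  funext i
  have : i = 0 := Subsingleton.elim (α := Fin 1) i 0
  subst this
  exact h

theorem vert_vtx (s : Verts (Digr.filteredNerve l X).toSSet) : vert l (vtx s) = s :=
  vert_ext rfl

/-- The edge of the filtered nerve from `x` to `y`. -/
def edge {x y : X.V} (h : X.dist x y ≤ l) : SSet.Edge (vert l x) (vert l y) :=
  SSet.Edge.mk (simplex (n := 1) ![x, y] (seqLength_one.trans_le h))
    (vert_ext rfl) (vert_ext rfl)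

/-- A 1-simplex is just its pair of endpoints, so the generators can be indexed by pairs of
vertices. -/
theorem edge_ext {s t : Verts (Digr.filteredNerve l X).toSSet} (e e' : SSet.Edge s t) : e = e' := by
  apply SSet.Edge.ext
  apply Subtype.ext
  apply Subtype.ext
  funext i
  revert i
  refine Fin.forall_fin_two.2 ⟨?_, ?_⟩
  · exact (edge_src e).trans (edge_src e').symm
  · exact (edge_tgt e).trans (edge_tgt e').symm

/-- The morphism of the `l`-fundamental groupoid given by a pair of vertices at distance at most
`l`. -/
def ar {x y : X.V} (h : X.dist x y ≤ l) : ob l x ⟶ ob l y := FundGrpd.homMk (edge h)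

theorem ar_self {x : X.V} (h : X.dist x x ≤ l) : ar h = 𝟙 (ob l x) := by
  rw [← FundGrpd.homMk_id, ar, edge_ext (edge h)]

/-- The bound on the total length is exactly what makes `(x, y, z)` a 2-simplex of the filtered
nerve. -/
theorem ar_comp {x y z : X.V} (h : X.dist x y + X.dist y z ≤ l) :
    ar (le_self_add.trans h) ≫ ar (le_add_self.trans h) = ar ((X.dist_triangle x y z).trans h) := by
  refine FundGrpd.homMk_comp (SSet.Edge.CompStruct.mk
    (simplex (n := 2) ![x, y, z] (seqLength_two.trans_le h)) ?_ ?_ ?_) <;>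
  · apply Subtype.ext
    apply Subtype.ext
    funext i
    revert i
    exact Fin.forall_fin_two.2 ⟨rfl, rfl⟩

theorem ar_comp_ar {x y z : X.V} (hxy : X.dist x y ≤ l) (hyz : X.dist y z ≤ l)
    (hxz : X.dist x z ≤ l) (h : X.dist x y + X.dist y z ≤ l) : ar hxy ≫ ar hyz = ar hxz :=
  ar_comp h

theorem ob_injective : Function.Injective (ob l (X := X)) := fun _ _ h =>
  congrArg vtx (FundGrpd.mk_injective h)

theorem exists_ob (a : LPi l X) : ∃ x : X.V, ob l x = a := by
  obtain ⟨s, rfl⟩ := FundGrpd.exists_mk a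
  exact ⟨vtx s, congrArg FundGrpd.mk (vert_vtx s)⟩

/-- A property of morphisms of the `l`-fundamental groupoid that holds for the generators and is
closed under identities, composition and inversion holds for all morphisms. -/
theorem induction (P : ∀ {x y : X.V}, (ob l x ⟶ ob l y) → Prop)
    (har : ∀ {x y : X.V} (h : X.dist x y ≤ l), P (ar h))
    (hcomp : ∀ {x y z : X.V} (f : ob l x ⟶ ob l y) (g : ob l y ⟶ ob l z), P f → P g → P (f ≫ g))
    (hinv : ∀ {x y : X.V} (f : ob l x ⟶ ob l y), P f → P (Groupoid.inv f))
    {x y : X.V} (f : ob l x ⟶ ob l y) : P f := by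
  -- An object is of the form `ob l x` only up to a propositional equality, so `P` is extended to
  -- all morphisms by inserting `eqToHom` at both ends.
  let W : MorphismProperty (LPi l X) := fun a b f =>
    ∀ (x y : X.V) (hx : ob l x = a) (hy : ob l y = b), P (eqToHom hx ≫ f ≫ eqToHom hy.symm)
  have hW : W.IsMultiplicative :=
    { id_mem := by
        intro a x y hx hy
        obtain rfl := ob_injective (hx.trans hy.symm)
        subst hx
        have := har (x := x) (y := x) (by simp)
        rw [ar_self] at this
        simpa using this
      comp_mem := by
        intro a b c f g hf hg x z hx hz
        obtain ⟨y, rfl⟩ := exists_ob b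
        subst hx hz
        simpa using hcomp _ _ (hf x y rfl rfl) (hg y z rfl rfl) }
  have := FundGrpd.hom_induction W (by
      intro a b f hf x y hx hy
      subst hx hy
      simpa using hinv _ (hf y x rfl rfl)) (by
      intro s t e x y hx hy
      obtain rfl := FundGrpd.mk_injective hx
      obtain rfl := FundGrpd.mk_injective hy
      have := har (edge_dist e)
      rw [ar, edge_ext (edge (edge_dist e)) e] at this
      have h2 : P (FundGrpd.homMk e : ob l x ⟶ ob l y) := this
      simpa using h2) f x y rfl rfl
  simpa using this

/-- A family of bijections indexed by the pairs of vertices at distance at most `l`, compatible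
with paths of length at most `l`, defines a functor. -/
def rep (F : X.V → Type u) (T : ∀ {x y : X.V}, X.dist x y ≤ l → (F x ≃ F y))
    (T_self : ∀ {x : X.V} (h : X.dist x x ≤ l) (e : F x), T h e = e)
    (T_comp : ∀ {x y z : X.V} (h : X.dist x y + X.dist y z ≤ l) (e : F x),
      T (le_add_self.trans h) (T (le_self_add.trans h) e) =
        T ((X.dist_triangle x y z).trans h) e) : LPi l X ⥤ Core (Type u) :=
  FundGrpd.lift (fun s => ⟨F (vtx s)⟩) (fun e => ⟨(T (edge_dist e)).toIso⟩)
    (fun s => by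
      ext e
      exact T_self _ e)
    (fun z => by
      ext e
      exact T_comp (simplex_dist z) e)

end LPi

/-! ### Arrows, short distances and connectedness. -/

namespace Digr

theorem dist_le_one_iff (X : Digr.{u}) {x y : X.V} : X.dist x y ≤ 1 ↔ X.E1 x y := by
  constructor
  · intro h
    obtain ⟨p, rfl, rfl, hp⟩ := X.exists_path (h.trans_lt (by simp))
    rw [← hp] at h
    have hl : p.length ≤ 1 := by exact_mod_cast h
    by_cases h0 : p.length = 0
    · left
      simp only [RelSeries.head, RelSeries.last]
      congr 1
      ext
      simp [h0]
    · have := p.eraseLast_last_rel_last h0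
      rw [RelSeries.last_eraseLast] at this
      have h1 : (⟨p.length.pred, Nat.lt_succ_iff.2 (Nat.pred_le _)⟩ : Fin (p.length + 1)) = 0 := by
        ext
        simp
        omega
      rw [h1] at this
      exact this
  · intro h
    let s : X.Path := ⟨1, ![x, y], fun i => by
      obtain rfl : i = 0 := Subsingleton.elim i 0
      exact h⟩
    simpa [s, RelSeries.head, RelSeries.last] using X.dist_le_of_path s

theorem exists_of_dist_le_succ (X : Digr.{u}) {k : ℕ} {x y : X.V}
    (h : X.dist x y ≤ (k + 1 : ℕ)) : ∃ z, X.dist x z ≤ k ∧ X.E1 z y := by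
  obtain ⟨p, rfl, rfl, hp⟩ := X.exists_path (h.trans_lt (ENat.natCast_lt_top _))
  rw [← hp] at h
  have hl : p.length ≤ k + 1 := by exact_mod_cast h
  by_cases h0 : p.length = 0
  · refine ⟨p.head, by simp, Or.inl ?_⟩
    simp only [RelSeries.head, RelSeries.last]
    congr 1
    ext
    simp [h0]
  · refine ⟨p.eraseLast.last, ?_, p.eraseLast_last_rel_last h0⟩
    refine (X.dist_le_of_path p.eraseLast).trans ?_
    have : p.eraseLast.length ≤ k := by
      rw [RelSeries.eraseLast_length]
      omega
    exact_mod_cast this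

/-- The hypothesis `1 ≤ l` serves to make every arrow a generator of the groupoid. -/
theorem E1.dist_le {X : Digr.{u}} {x y : X.V} (h : X.E1 x y) {l : ℕ} (hl : 1 ≤ l) :
    X.dist x y ≤ l :=
  ((X.dist_le_one_iff).2 h).trans (by exact_mod_cast hl)

/-- A relation that holds along arrows and is reflexive, symmetric and transitive holds for all
pairs of vertices of a connected digraph. -/
theorem Connected.induction {X : Digr.{u}} (hX : X.Connected) (r : X.V → X.V → Prop)
    (hr : Equivalence r) (h : ∀ x y, X.E1 x y → r x y) (x y : X.V) : r x y := by
  obtain ⟨w⟩ := hX.preconnected x y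
  induction w with
  | nil => exact hr.refl _
  | cons hadj _ ih =>
    refine hr.trans ?_ ih
    rcases hadj.2 with h' | h'
    · exact h _ _ (Or.inr h')
    · exact hr.symm (h _ _ (Or.inr h'))

theorem reachable_of_E1 {X : Digr.{u}} {x y : X.V} (h : X.E1 x y) :
    X.graph.toSimpleGraphInclusive.Reachable x y := by
  rcases h with rfl | h
  · exact .refl _
  · refine SimpleGraph.Adj.reachable ⟨?_, Or.inl h⟩
    rintro rfl
    exact X.loopless _ h

theorem reachable_of_dist_le {X : Digr.{u}} {x : X.V} {k : ℕ} :
    ∀ {y : X.V}, X.dist x y ≤ k → X.graph.toSimpleGraphInclusive.Reachable x y := by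
  induction k with
  | zero =>
    intro y h
    obtain rfl := X.eq_of_dist_eq_zero (by simpa using h)
    exact .refl _
  | succ k ih =>
    intro y h
    obtain ⟨z, hz, hzy⟩ := X.exists_of_dist_le_succ h
    exact (ih hz).trans (reachable_of_E1 hzy)

end Digr

/-! ### Monodromy, lifting and faithfulness. -/

namespace LPi

variable {l : ℕ} {E X : Digr.{u}}

/-- In a connected digraph any two vertices are connected by a morphism of the `l`-fundamental
groupoid. -/
theorem exists_hom (hl : 1 ≤ l) (hX : X.Connected) (x y : X.V) : Nonempty (ob l x ⟶ ob l y) :=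
  hX.induction (fun x y => Nonempty (ob l x ⟶ ob l y))
    ⟨fun _ => ⟨𝟙 _⟩, fun ⟨f⟩ => ⟨Groupoid.inv f⟩, fun ⟨f⟩ ⟨g⟩ => ⟨f ≫ g⟩⟩
    (fun _ _ h => ⟨ar (h.dist_le hl)⟩) x y

/-- The action of a morphism through a functor to sets and bijections. -/
def act (R : LPi l X ⥤ Core (Type u)) {a b : LPi l X} (γ : a ⟶ b) (e : (R.obj a).of) :
    (R.obj b).of :=
  (R.map γ).iso.hom e

section act

variable (R : LPi l X ⥤ Core (Type u))

@[simp] theorem act_id (a : LPi l X) (e : (R.obj a).of) : act R (𝟙 a) e = e := by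
  rw [act, CategoryTheory.Functor.map_id]
  rfl

theorem act_comp {a b c : LPi l X} (γ : a ⟶ b) (δ : b ⟶ c) (e : (R.obj a).of) :
    act R (γ ≫ δ) e = act R δ (act R γ e) := by
  rw [act, CategoryTheory.Functor.map_comp]
  rfl

@[simp] theorem act_inv_act {a b : LPi l X} (γ : a ⟶ b) (e : (R.obj a).of) :
    act R (Groupoid.inv γ) (act R γ e) = e := by
  rw [← act_comp, Groupoid.comp_inv, act_id]

@[simp] theorem act_act_inv {a b : LPi l X} (γ : a ⟶ b) (e : (R.obj b).of) :
    act R γ (act R (Groupoid.inv γ) e) = e := by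
  rw [← act_comp, Groupoid.inv_comp, act_id]

theorem act_rep_ar (F : X.V → Type u) (T : ∀ {x y : X.V}, X.dist x y ≤ l → (F x ≃ F y))
    (T_self : ∀ {x : X.V} (h : X.dist x x ≤ l) (e : F x), T h e = e)
    (T_comp : ∀ {x y z : X.V} (h : X.dist x y + X.dist y z ≤ l) (e : F x),
      T (le_add_self.trans h) (T (le_self_add.trans h) e) =
        T ((X.dist_triangle x y z).trans h) e) {x y : X.V} (h : X.dist x y ≤ l) (e : F x) :
    act (rep F T T_self T_comp) (ar h) e = T h e := by
  have : (rep F T T_self T_comp).map (ar h) = ⟨(T h).toIso⟩ := by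
    unfold rep ar
    rw [FundGrpd.lift_map_homMk]
    · rfl
    · intro _ _ _ _ _ _ z
      ext e
      exact T_comp (simplex_dist z) e
  unfold act
  rw [this]
  rfl

end act

/-- The morphism of the `l`-fundamental groupoid induced by a morphism of digraphs. -/
def push (p : E ⟶ X) {e e' : E.V} (γ : ob l e ⟶ ob l e') :
    ob l (p.toFun e) ⟶ ob l (p.toFun e') :=
  (lPiMap l p).map γ

theorem push_ar (p : E ⟶ X) {e e' : E.V} (h : E.dist e e' ≤ l) :
    push p (ar h) = ar ((Digr.dist_map_le p e e').trans h) := by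
  refine (FundGrpd.map_homMk _ _).trans ?_
  exact congrArg FundGrpd.homMk (edge_ext _ _)

@[simp] theorem push_id (p : E ⟶ X) (e : E.V) : push p (𝟙 (ob l e)) = 𝟙 _ :=
  (lPiMap l p).map_id _

theorem push_comp (p : E ⟶ X) {a b c : E.V} (γ : ob l a ⟶ ob l b) (δ : ob l b ⟶ ob l c) :
    push p (γ ≫ δ) = push p γ ≫ push p δ :=
  (lPiMap l p).map_comp _ _

theorem push_inv (p : E ⟶ X) {a b : E.V} (γ : ob l a ⟶ ob l b) :
    push p (Groupoid.inv γ) = Groupoid.inv (push p γ) := by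
  rw [← cancel_epi (push p γ), ← push_comp, Groupoid.comp_inv, Groupoid.comp_inv, push_id]

variable {p : E ⟶ X}

/-- The fibre of a morphism of digraphs over a vertex. -/
abbrev Fib (p : E ⟶ X) (x : X.V) : Type u := {e : E.V // p.toFun e = x}

/-- The action of the `l`-fundamental groupoid on the fibres of an `l`-covering. -/
def mon (h : Digr.IsCovering l p) {x y : X.V} (γ : ob l x ⟶ ob l y) (e : Fib p x) : Fib p y :=
  act (monodromy h) γ e

variable (h : Digr.IsCovering l p)

theorem mon_comp {x y z : X.V} (γ : ob l x ⟶ ob l y) (δ : ob l y ⟶ ob l z) (e : Fib p x) :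
    mon h (γ ≫ δ) e = mon h δ (mon h γ e) := act_comp _ _ _ _

@[simp] theorem mon_inv_mon {x y : X.V} (γ : ob l x ⟶ ob l y) (e : Fib p x) :
    mon h (Groupoid.inv γ) (mon h γ e) = e := act_inv_act _ _ _

@[simp] theorem mon_mon_inv {x y : X.V} (γ : ob l x ⟶ ob l y) (e : Fib p y) :
    mon h γ (mon h (Groupoid.inv γ) e) = e := act_act_inv _ _ _

theorem transport_self {x : X.V} (hx : X.dist x x ≤ l) (e : Fib p x) : transport h hx e = e :=
  transport_eq h _ _ _ (by simp)

/-- The two successive lifts have the same lengths as their images, so their endpoints are at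
distance at most `l`, and uniqueness of lifts applies. -/
theorem transport_trans {x y z : X.V} (hxyz : X.dist x y + X.dist y z ≤ l) (e : Fib p x) :
    transport h (le_add_self.trans hxyz) (transport h (le_self_add.trans hxyz) e) =
      transport h ((X.dist_triangle x y z).trans hxyz) e := by
  refine (transport_eq h _ _ _ ((E.dist_triangle _ (transport h (le_self_add.trans hxyz) e).1
    _).trans ?_)).symm
  rw [h.dist_eq (transport_dist h _ _), h.dist_eq (transport_dist h _ _), e.2,
    (transport h (le_self_add.trans hxyz) e).2, (transport h (le_add_self.trans hxyz) _).2]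
  exact hxyz

theorem mon_ar {x y : X.V} (hxy : X.dist x y ≤ l) (e : Fib p x) :
    mon h (ar hxy) e = transport h hxy e := by
  have : (monodromy h).map (ar hxy) = ⟨(transport h hxy).toIso⟩ := by
    unfold monodromy ar
    rw [FundGrpd.lift_map_homMk]
    · rfl
    · intro _ _ _ _ _ _ z
      ext e
      exact congrArg Subtype.val (transport_trans h (simplex_dist z) e)
  unfold mon act
  rw [this]
  rfl

/-- The lift of an image is the original morphism; on generators this is uniqueness of lifts. -/
theorem mon_push {e e' : E.V} (γ : ob l e ⟶ ob l e') :
    mon h (push p γ) ⟨e, rfl⟩ = ⟨e', rfl⟩ := by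
  induction γ using induction with
  | har hee =>
    rw [push_ar, mon_ar]
    exact transport_eq h _ _ _ hee
  | hcomp f g hf hg => rw [push_comp, mon_comp, hf, hg]
  | hinv f hf => rw [push_inv, ← hf, mon_inv_mon]

/-- Morphisms of the `l`-fundamental groupoid lift along an `l`-covering. -/
theorem exists_lift (h : Digr.IsCovering l p) {x y : X.V} (δ : ob l x ⟶ ob l y) :
    (∀ e : Fib p x, ∃ (e' : Fib p y) (γ : ob l e.1 ⟶ ob l e'.1),
      push p γ = eqToHom (congrArg (ob l) e.2) ≫ δ ≫ eqToHom (congrArg (ob l) e'.2.symm)) ∧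
    (∀ e' : Fib p y, ∃ (e : Fib p x) (γ : ob l e.1 ⟶ ob l e'.1),
      push p γ = eqToHom (congrArg (ob l) e.2) ≫ δ ≫ eqToHom (congrArg (ob l) e'.2.symm)) := by
  -- Lifts with prescribed start and with prescribed end are treated together because inversion
  -- exchanges them.
  induction δ using induction with
  | har hxy =>
    constructor
    · rintro ⟨e, rfl⟩
      obtain ⟨e', ⟨rfl, h2⟩, -⟩ := h.existsUnique_head e _ hxy
      exact ⟨⟨e', rfl⟩, ar h2, by simp [push_ar]⟩
    · rintro ⟨e, rfl⟩
      obtain ⟨e', ⟨rfl, h2⟩, -⟩ := h.existsUnique_tail e _ hxy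
      exact ⟨⟨e', rfl⟩, ar h2, by simp [push_ar]⟩
  | hcomp f g hf hg =>
    constructor
    · intro e
      obtain ⟨e', γ, h1⟩ := hf.1 e
      obtain ⟨e'', γ', h2⟩ := hg.1 e'
      exact ⟨e'', γ ≫ γ', by rw [push_comp, h1, h2]; simp⟩
    · intro e
      obtain ⟨e', γ, h1⟩ := hg.2 e
      obtain ⟨e'', γ', h2⟩ := hf.2 e'
      exact ⟨e'', γ' ≫ γ, by rw [push_comp, h1, h2]; simp⟩
  | hinv f hf =>
    constructor
    · intro e
      obtain ⟨⟨e', rfl⟩, γ, h1⟩ := hf.2 e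
      obtain ⟨e, rfl⟩ := e
      exact ⟨⟨e', rfl⟩, Groupoid.inv γ, by rw [push_inv, h1]; simp⟩
    · intro e
      obtain ⟨⟨e', rfl⟩, γ, h1⟩ := hf.1 e
      obtain ⟨e, rfl⟩ := e
      exact ⟨⟨e', rfl⟩, Groupoid.inv γ, by rw [push_inv, h1]; simp⟩

/-- A morphism of `X` that sends `e` to `e'` is the image of a morphism from `e` to `e'`. -/
theorem exists_push_eq {e e' : E.V} (δ : ob l (p.toFun e) ⟶ ob l (p.toFun e'))
    (he : mon h δ ⟨e, rfl⟩ = ⟨e', rfl⟩) : ∃ γ : ob l e ⟶ ob l e', push p γ = δ := by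
  obtain ⟨⟨e'', h2⟩, γ, h1⟩ := (exists_lift h δ).1 ⟨e, rfl⟩
  have h3 : mon h (push p γ) ⟨e, rfl⟩ = ⟨e'', rfl⟩ := mon_push h γ
  have h4 : e'' = e' := by
    have h5 := congrArg Subtype.val he
    -- With the endpoint `y` generalized, the equality `p e'' = y` can be substituted away.
    have key : ∀ (y : X.V) (hy : p.toFun e'' = y) (δ : ob l (p.toFun e) ⟶ ob l y),
        push p γ = δ ≫ eqToHom (congrArg (ob l) hy.symm) → (mon h δ ⟨e, rfl⟩).1 = e'' := by
      rintro _ rfl δ hδ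
      simp only [eqToHom_refl, Category.comp_id] at hδ
      rw [← hδ, h3]
    rw [key _ h2 δ (by simpa using h1)] at h5
    exact h5
  subst h4
  exact ⟨γ, by simpa using h1⟩

/-- The morphisms from `e₀` to points of the fibre over `x`. -/
abbrev PathFib (l : ℕ) (p : E ⟶ X) (e₀ : E.V) (x : X.V) : Type u :=
  Σ e : Fib p x, (ob l e₀ ⟶ ob l e.1)

/-- Replaces a heterogeneous equality of second components: the change of endpoint is absorbed by an
`ar` between equal vertices, which is an identity. -/
theorem PathFib.eq_of_ar {e₀ : E.V} {x : X.V} {v w : PathFib l p e₀ x} (h1 : v.1 = w.1)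
    (h2 : ∀ h3 : E.dist v.1.1 w.1.1 ≤ l, v.2 ≫ ar h3 = w.2) : v = w := by
  obtain ⟨e, f⟩ := v
  obtain ⟨e', g⟩ := w
  obtain rfl : e = e' := h1
  have := h2 (by simp)
  rw [ar_self, Category.comp_id] at this
  exact congrArg (Sigma.mk e) this

/-- Composition with the lift of a pair of vertices at distance at most `l`. -/
def pathTransport (e₀ : E.V) {x y : X.V} (hxy : X.dist x y ≤ l) :
    PathFib l p e₀ x ≃ PathFib l p e₀ y :=
  Equiv.ofBijective
    (fun w => (⟨transport h hxy w.1, w.2 ≫ ar (transport_dist h hxy w.1)⟩ : PathFib l p e₀ y)) (by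
    constructor
    · rintro ⟨e, f⟩ ⟨e', f'⟩ hw
      obtain rfl := (transport h hxy).injective (Sigma.mk.inj hw).1
      have := eq_of_heq (Sigma.mk.inj hw).2
      rw [cancel_mono] at this
      exact congrArg (Sigma.mk e) this
    · rintro ⟨e, f⟩
      obtain ⟨e, rfl⟩ := (transport h hxy).surjective e
      exact ⟨⟨e, f ≫ Groupoid.inv (ar (transport_dist h hxy e))⟩, by simp⟩)

theorem pathTransport_apply (e₀ : E.V) {x y : X.V} (hxy : X.dist x y ≤ l)
    (w : PathFib l p e₀ x) :
    pathTransport h e₀ hxy w = ⟨transport h hxy w.1, w.2 ≫ ar (transport_dist h hxy w.1)⟩ := rfl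

theorem pathTransport_self (e₀ : E.V) {x : X.V} (hx : X.dist x x ≤ l) (w : PathFib l p e₀ x) :
    pathTransport h e₀ hx w = w := by
  rw [pathTransport_apply]
  refine PathFib.eq_of_ar (transport_self h hx w.1) fun h3 => ?_
  dsimp only at h3 ⊢
  rw [Category.assoc, ar_comp_ar _ _ (by simp), ar_self, Category.comp_id]
  rw [transport_self]
  simp

/-- The lifted triple has total length at most `l` in `E`, so the relation of that 2-simplex holds
in `Π^l(E)`. -/
theorem pathTransport_trans (e₀ : E.V) {x y z : X.V} (hxyz : X.dist x y + X.dist y z ≤ l)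
    (w : PathFib l p e₀ x) :
    pathTransport h e₀ (le_add_self.trans hxyz)
        (pathTransport h e₀ (le_self_add.trans hxyz) w) =
      pathTransport h e₀ ((X.dist_triangle x y z).trans hxyz) w := by
  simp only [pathTransport_apply]
  refine PathFib.eq_of_ar (transport_trans h hxyz w.1) fun h3 => ?_
  have h4 := transport_dist h ((X.dist_triangle x y z).trans hxyz) w.1
  dsimp only at h3 ⊢
  simp only [Category.assoc]
  have h5 := transport_trans h hxyz w.1
  have h6 : E.dist w.1.1 (transport h (le_self_add.trans hxyz) w.1).1 +
      E.dist (transport h (le_self_add.trans hxyz) w.1).1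
        (transport h ((X.dist_triangle x y z).trans hxyz) w.1).1 ≤ l := by
    rw [← h5, h.dist_eq (transport_dist h _ _), h.dist_eq (transport_dist h _ _), w.1.2,
      (transport h (le_self_add.trans hxyz) w.1).2, (transport h (le_add_self.trans hxyz) _).2]
    exact hxyz
  rw [ar_comp_ar _ _ (le_add_self.trans h6), ar_comp_ar _ _ h4 h6]
  rw [h5]
  simpa using le_add_self.trans h6

/-- The functor that sends a vertex `x` to the set of morphisms from `e₀` to points over `x`. -/
def pathRep (e₀ : E.V) : LPi l X ⥤ Core (Type u) :=
  rep (PathFib l p e₀) (pathTransport h e₀) (pathTransport_self h e₀) (pathTransport_trans h e₀)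

/-- Composition with lifts of morphisms. -/
def pathAct (e₀ : E.V) {x y : X.V} (γ : ob l x ⟶ ob l y) (w : PathFib l p e₀ x) :
    PathFib l p e₀ y :=
  act (pathRep h e₀) γ w

theorem pathAct_comp (e₀ : E.V) {x y z : X.V} (γ : ob l x ⟶ ob l y) (δ : ob l y ⟶ ob l z)
    (w : PathFib l p e₀ x) : pathAct h e₀ (γ ≫ δ) w = pathAct h e₀ δ (pathAct h e₀ γ w) :=
  act_comp _ _ _ _

theorem pathAct_inv_pathAct (e₀ : E.V) {x y : X.V} (γ : ob l x ⟶ ob l y) (w : PathFib l p e₀ x) :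
    pathAct h e₀ (Groupoid.inv γ) (pathAct h e₀ γ w) = w :=
  act_inv_act _ _ _

/-- This action remembers the lifted morphism and not only its endpoint, which is what faithfulness
needs. -/
theorem pathAct_push (e₀ : E.V) {e e' : E.V} (γ : ob l e ⟶ ob l e') (g : ob l e₀ ⟶ ob l e) :
    pathAct h e₀ (push p γ) ⟨⟨e, rfl⟩, g⟩ = ⟨⟨e', rfl⟩, g ≫ γ⟩ := by
  induction γ using induction with
  | har hee =>
    rw [push_ar]
    refine (act_rep_ar _ _ _ _ _ _).trans ?_
    have h1 := transport_eq h ((Digr.dist_map_le p _ _).trans hee) ⟨_, rfl⟩ ⟨_, rfl⟩ hee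
    rw [pathTransport_apply]
    refine PathFib.eq_of_ar h1 fun h3 => ?_
    dsimp only at h3 ⊢
    rw [Category.assoc, ar_comp_ar _ _ hee]
    rw [h1]
    simpa using hee
  | hcomp f f' hf hf' => rw [push_comp, pathAct_comp, hf, hf', Category.assoc]
  | hinv f hf =>
    have := hf (g ≫ Groupoid.inv f)
    rw [Category.assoc, Groupoid.inv_comp, Category.comp_id] at this
    rw [push_inv, ← this, pathAct_inv_pathAct]

/-- An `l`-covering induces a faithful functor of `l`-fundamental groupoids. -/
theorem push_injective (h : Digr.IsCovering l p) {e e' : E.V} :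
    Function.Injective (push p : (ob l e ⟶ ob l e') → _) := by
  intro γ γ' hγ
  have h1 := pathAct_push h e γ (𝟙 _)
  rw [hγ, pathAct_push] at h1
  simpa using (eq_of_heq (Sigma.mk.inj h1).2).symm

end LPi

/-! ### Coverings from unique lifts. -/

namespace Digr

theorem isOneCovering_of_existsUnique {E X : Digr.{u}} {p : E ⟶ X}
    (hhead : ∀ (e : E.V) (x : X.V), X.E1 (p.toFun e) x → ∃! e', p.toFun e' = x ∧ E.E1 e e')
    (htail : ∀ (e : E.V) (x : X.V), X.E1 x (p.toFun e) → ∃! e', p.toFun e' = x ∧ E.E1 e' e) :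
    IsOneCovering p where
  star_bijective e := by
    constructor
    · rintro ⟨a, ⟨ha⟩⟩ ⟨b, ⟨hb⟩⟩ hab
      have h1 : p.toFun a = p.toFun b := congrArg Sigma.fst hab
      obtain rfl := (hhead e _ (p.map_E1 ha)).unique ⟨rfl, ha⟩ ⟨h1.symm, hb⟩
      rfl
    · rintro ⟨x, ⟨hx⟩⟩
      obtain ⟨a, ⟨rfl, ha⟩, -⟩ := hhead e x hx
      exact ⟨⟨a, ⟨ha⟩⟩, rfl⟩
  costar_bijective e := by
    constructor
    · rintro ⟨a, ⟨ha⟩⟩ ⟨b, ⟨hb⟩⟩ hab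
      have h1 : p.toFun a = p.toFun b := congrArg Sigma.fst hab
      obtain rfl := (htail e _ (p.map_E1 ha)).unique ⟨rfl, ha⟩ ⟨h1.symm, hb⟩
      rfl
    · rintro ⟨x, ⟨hx⟩⟩
      obtain ⟨a, ⟨rfl, ha⟩, -⟩ := htail e x hx
      exact ⟨⟨a, ⟨ha⟩⟩, rfl⟩

end Digr

/-! ### The covering associated with a subgroup. -/

namespace SubgroupCover

open LPi

variable {l : ℕ} {X : PDigr.{u}} (H : Subgroup (pi1 l X))

/-- Morphisms out of the basepoint, up to precomposition with elements of `H`. -/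
def pathSetoid (x : X.X.V) : Setoid (ob l X.pt ⟶ ob l x) where
  r g g' := ∃ η : ob l X.pt ⟶ ob l X.pt, End.of η ∈ H ∧ η ≫ g = g'
  iseqv :=
    { refl := fun g => ⟨𝟙 _, H.one_mem, Category.id_comp g⟩
      symm := by
        rintro g _ ⟨η, hη, rfl⟩
        exact ⟨Groupoid.inv η, H.inv_mem hη, by simp⟩
      trans := by
        rintro g _ _ ⟨η, hη, rfl⟩ ⟨θ, hθ, rfl⟩
        -- The product `η * θ` in `End` is `θ` followed by `η`.
        exact ⟨θ ≫ η, H.mul_mem hη hθ, by simp⟩ }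

/-- The fibre over `x` of the covering associated with `H`. -/
def Coset (x : X.X.V) : Type u := _root_.Quotient (pathSetoid H x)

variable {H}

/-- The class of a morphism. -/
def Coset.mk {x : X.X.V} (g : ob l X.pt ⟶ ob l x) : Coset H x :=
  _root_.Quotient.mk (pathSetoid H x) g

theorem Coset.mk_surjective {x : X.X.V} : Function.Surjective (Coset.mk (H := H) (x := x)) :=
  Quot.mk_surjective

theorem Coset.mk_eq_iff {x : X.X.V} {g g' : ob l X.pt ⟶ ob l x} :
    (Coset.mk g : Coset H x) = Coset.mk g' ↔
      ∃ η : ob l X.pt ⟶ ob l X.pt, End.of η ∈ H ∧ η ≫ g = g' :=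
  _root_.Quotient.eq (r := pathSetoid H x)

/-- Composition of classes with a morphism. -/
def translate {x y : X.X.V} (δ : ob l x ⟶ ob l y) : Coset H x → Coset H y :=
  _root_.Quotient.map (fun g => g ≫ δ) (by
    rintro g _ ⟨η, hη, rfl⟩
    exact ⟨η, hη, (Category.assoc _ _ _).symm⟩)

theorem translate_mk {x y : X.X.V} (g : ob l X.pt ⟶ ob l x) (δ : ob l x ⟶ ob l y) :
    translate δ (Coset.mk g : Coset H x) = Coset.mk (g ≫ δ) := rfl

@[simp] theorem translate_id {x : X.X.V} (a : Coset H x) : translate (𝟙 _) a = a := by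
  obtain ⟨g, rfl⟩ := Coset.mk_surjective a
  rw [translate_mk, Category.comp_id]

theorem translate_comp {x y z : X.X.V} (γ : ob l x ⟶ ob l y) (δ : ob l y ⟶ ob l z)
    (a : Coset H x) : translate (γ ≫ δ) a = translate δ (translate γ a) := by
  obtain ⟨g, rfl⟩ := Coset.mk_surjective a
  rw [translate_mk, translate_mk, translate_mk, Category.assoc]

@[simp] theorem translate_inv_translate {x y : X.X.V} (γ : ob l x ⟶ ob l y) (a : Coset H x) :
    translate (Groupoid.inv γ) (translate γ a) = a := by
  rw [← translate_comp, Groupoid.comp_inv, translate_id]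

@[simp] theorem translate_translate_inv {x y : X.X.V} (γ : ob l x ⟶ ob l y) (a : Coset H y) :
    translate γ (translate (Groupoid.inv γ) a) = a := by
  rw [← translate_comp, Groupoid.inv_comp, translate_id]

variable (H)

/-- The total digraph of the covering associated with `H`. -/
def total : Digr.{u} where
  V := Σ x : X.X.V, Coset H x
  graph := ⟨fun v w => X.X.graph.Adj v.1 w.1 ∧
    -- For adjacent vertices the bound is automatic when `1 ≤ l`; quantifying over it gives a
    -- definition for every `l`.
    ∃ h : X.X.dist v.1 w.1 ≤ l, translate (ar h) v.2 = w.2⟩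
  loopless _ h := X.X.loopless _ h.1

/-- The projection of the covering associated with `H`. -/
def proj : total H ⟶ X.X where
  toFun := Sigma.fst
  map_E1 := by
    rintro v w (rfl | h)
    · exact Or.inl rfl
    · exact Or.inr h.1

variable {H}

theorem total_E1_iff {v w : (total H).V} :
    (total H).E1 v w ↔ X.X.E1 v.1 w.1 ∧
      ∃ h : X.X.dist v.1 w.1 ≤ l, translate (ar h) v.2 = w.2 := by
  constructor
  · rintro (rfl | h)
    · exact ⟨Or.inl rfl, by simp, by rw [ar_self, translate_id]⟩
    · exact ⟨Or.inr h.1, h.2⟩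
  · obtain ⟨x, a⟩ := v
    obtain ⟨y, b⟩ := w
    rintro ⟨h1, h2, h3⟩
    rcases h1 with h1 | h1
    · dsimp only at h1 h2 h3
      subst h1
      rw [ar_self, translate_id] at h3
      exact Or.inl (congrArg (Sigma.mk x) h3)
    · exact Or.inr ⟨h1, h2, h3⟩

/-- Induction on `n`, splitting off the last arrow of a path. Translation along the initial part and
then along that arrow is translation along the pair of endpoints, since the total length is at most
`n ≤ l`. -/
theorem total_dist_le_iff {n : ℕ} (hn : n ≤ l) {v w : (total H).V} :
    (total H).dist v w ≤ n ↔ X.X.dist v.1 w.1 ≤ n ∧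
      ∃ h : X.X.dist v.1 w.1 ≤ l, translate (ar h) v.2 = w.2 := by
  induction n generalizing w with
  | zero =>
    constructor
    · intro h
      obtain rfl := (total H).eq_of_dist_eq_zero (by simpa using h)
      exact ⟨by simp, by simp, by rw [ar_self, translate_id]⟩
    · obtain ⟨x, a⟩ := v
      obtain ⟨y, b⟩ := w
      rintro ⟨h1, h2, h3⟩
      dsimp only at h1 h2 h3
      obtain rfl := X.X.eq_of_dist_eq_zero (by simpa using h1)
      rw [ar_self, translate_id] at h3
      subst h3
      exact ((total H).dist_self _).le.trans zero_le
  | succ k ih =>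
    have ih {w} := @ih (by omega) w
    have hcast : ((k : ℕ∞) + 1) ≤ l := by exact_mod_cast hn
    constructor
    · intro h
      obtain ⟨z, hz, hzw⟩ := (total H).exists_of_dist_le_succ h
      obtain ⟨h1, h2, h3⟩ := ih.1 hz
      obtain ⟨h4, h5, h6⟩ := total_E1_iff.1 hzw
      have hle := (Digr.dist_map_le (proj H) v w).trans h
      have hle' : X.X.dist v.1 w.1 ≤ l := hle.trans (by exact_mod_cast hn)
      refine ⟨hle, hle', ?_⟩
      have h7 : translate (ar hle') v.2 = translate (ar h5) (translate (ar h2) v.2) := by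
        rw [← translate_comp, ar_comp_ar h2 h5 hle']
        exact (add_le_add h1 (X.X.dist_le_one_iff.2 h4)).trans hcast
      exact h7.trans ((congrArg _ h3).trans h6)
    · rintro ⟨h1, h2, h3⟩
      obtain ⟨z, hz, hzw⟩ := X.X.exists_of_dist_le_succ h1
      have hvz : X.X.dist v.1 z ≤ l := hz.trans (by exact_mod_cast (by omega : k ≤ l))
      have hzw' : X.X.dist z w.1 ≤ l := hzw.dist_le (by omega)
      have h4 : (total H).dist v ⟨z, translate (ar hvz) v.2⟩ ≤ k := ih.2 ⟨hz, hvz, rfl⟩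
      have h5 : (total H).E1 ⟨z, translate (ar hvz) v.2⟩ w := by
        refine total_E1_iff.2 ⟨hzw, hzw', ?_⟩
        rw [← h3, ← translate_comp, ar_comp_ar hvz hzw' h2]
        exact (add_le_add hz (X.X.dist_le_one_iff.2 hzw)).trans hcast
      refine ((total H).dist_triangle _ _ _).trans
        ((add_le_add h4 ((total H).dist_le_one_iff.2 h5)).trans (by simp))

/-- By the distance formula the lift of a pair with given start is the translate, and the lift with
given end is the inverse translate. -/
theorem isCovering_proj : Digr.IsCovering l (proj H) := by
  intro n _ hn
  have hcast : (n : ℕ∞) ≤ l := by exact_mod_cast hn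
  refine Digr.isOneCovering_of_existsUnique ?_ ?_
  · intro e x hx
    have hx' := (Digr.D_E1 n X.X _ _).1 hx
    refine ⟨⟨x, translate (ar (hx'.trans hcast)) e.2⟩,
      ⟨rfl, (Digr.D_E1 n _ _ _).2 ((total_dist_le_iff hn).2 ⟨hx', hx'.trans hcast, rfl⟩)⟩, ?_⟩
    rintro ⟨_, b⟩ ⟨rfl, hb⟩
    obtain ⟨h1, h2, h3⟩ := (total_dist_le_iff hn).1 ((Digr.D_E1 n _ _ _).1 hb)
    exact congrArg (Sigma.mk _) h3.symm
  · intro e x hx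
    have hx' := (Digr.D_E1 n X.X _ _).1 hx
    refine ⟨⟨x, translate (Groupoid.inv (ar (hx'.trans hcast))) e.2⟩,
      ⟨rfl, (Digr.D_E1 n _ _ _).2 ((total_dist_le_iff hn).2 ⟨hx', hx'.trans hcast, ?_⟩)⟩, ?_⟩
    · exact translate_translate_inv _ _
    rintro ⟨_, b⟩ ⟨rfl, hb⟩
    obtain ⟨h1, h2, h3⟩ := (total_dist_le_iff hn).1 ((Digr.D_E1 n _ _ _).1 hb)
    refine congrArg (Sigma.mk _) ?_
    exact (translate_inv_translate _ _).symm.trans (congrArg _ h3)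

theorem mon_proj {x y : X.X.V} (δ : ob l x ⟶ ob l y) (a : Coset H x) :
    mon (isCovering_proj (H := H)) δ ⟨⟨x, a⟩, rfl⟩ = ⟨⟨y, translate δ a⟩, rfl⟩ := by
  induction δ using induction with
  | har hxy =>
    rw [mon_ar]
    exact transport_eq _ _ _ _ ((total_dist_le_iff le_rfl).2 ⟨hxy, hxy, rfl⟩)
  | hcomp f g hf hg => rw [mon_comp, hf, hg, translate_comp]
  | hinv f hf =>
    have := hf (translate (Groupoid.inv f) a)
    rw [translate_translate_inv] at this
    rw [← this, mon_inv_mon]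

theorem reachable_translate {x y : X.X.V} (δ : ob l x ⟶ ob l y) (a : Coset H x) :
    (total H).graph.toSimpleGraphInclusive.Reachable ⟨x, a⟩ ⟨y, translate δ a⟩ := by
  induction δ using induction with
  | har hxy =>
    exact Digr.reachable_of_dist_le ((total_dist_le_iff le_rfl).2 ⟨hxy, hxy, rfl⟩)
  | hcomp f g hf hg =>
    rw [translate_comp]
    exact (hf a).trans (hg _)
  | hinv f hf =>
    have := hf (translate (Groupoid.inv f) a)
    rw [translate_translate_inv] at this
    exact this.symm

/-- The basepoint of the covering associated with `H`. -/
def pt : (total H).V := ⟨X.pt, Coset.mk (𝟙 _)⟩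

/-- The class of `g` is the translate of the base vertex along `g`. -/
theorem connected_total : (total H).Connected := by
  have h (v : (total H).V) :
      (total H).graph.toSimpleGraphInclusive.Reachable (pt (H := H)) v := by
    obtain ⟨x, a⟩ := v
    obtain ⟨g, rfl⟩ := Coset.mk_surjective a
    have := reachable_translate g (Coset.mk (H := H) (𝟙 _))
    rwa [translate_mk, Category.id_comp] at this
  exact { preconnected := fun v w => (h v).symm.trans (h w), nonempty := ⟨pt⟩ }

variable (H) in
/-- The connected pointed covering associated with `H`. -/
def cover : ConnCov l X :=
  ⟨Over.mk (Y := (⟨total H, pt⟩ : PDigr.{u})) ⟨proj H, rfl⟩, isCovering_proj, connected_total⟩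

end SubgroupCover

/-! ### The image of `p_*` as a stabilizer. -/

namespace LPi

variable {l : ℕ}

/-- Up to the identification of basepoints, `p_*` is the map induced on morphisms. -/
theorem pi1Map_mk {E X : Digr.{u}} (f : E ⟶ X) (e₀ : E.V) (γ : ob l e₀ ⟶ ob l e₀) :
    pi1Map l (E := ⟨E, e₀⟩) (X := ⟨X, f.toFun e₀⟩) ⟨f, rfl⟩ (End.of γ) = End.of (push f γ) := by
  change 𝟙 _ ≫ push f γ ≫ 𝟙 _ = push f γ
  rw [Category.comp_id, Category.id_comp]

/-- The basepoint `x₀` is a variable so that `hf` can be substituted and the conjugation by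
`eqToIso` in `pi1Map` disappears. -/
theorem pi1Map_injective_aux {E X : Digr.{u}} {f : E ⟶ X} {e₀ : E.V} {x₀ : X.V}
    (hf : f.toFun e₀ = x₀) (h : Digr.IsCovering l f) :
    Function.Injective (pi1Map l (E := ⟨E, e₀⟩) (X := ⟨X, x₀⟩) ⟨f, hf⟩) := by
  subst hf
  intro γ γ' hγ
  exact push_injective h ((pi1Map_mk f e₀ γ).symm.trans (hγ.trans (pi1Map_mk f e₀ γ')))

/-- The lift of an image loop is the loop itself; conversely, a loop that fixes `e₀` lifts to a loop
at `e₀`. -/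
theorem mem_range_pi1Map_iff_aux {E X : Digr.{u}} {f : E ⟶ X} {e₀ : E.V} {x₀ : X.V}
    (hf : f.toFun e₀ = x₀) (h : Digr.IsCovering l f) (γ : ob l x₀ ⟶ ob l x₀) :
    End.of γ ∈ (pi1Map l (E := ⟨E, e₀⟩) (X := ⟨X, x₀⟩) ⟨f, hf⟩).range ↔
      mon h γ ⟨e₀, hf⟩ = ⟨e₀, hf⟩ := by
  subst hf
  constructor
  · rintro ⟨δ, hδ⟩
    obtain rfl : push f δ = γ := (pi1Map_mk f e₀ δ).symm.trans hδ
    exact mon_push h δ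
  · intro hγ
    obtain ⟨δ, rfl⟩ := exists_push_eq h γ hγ
    exact ⟨δ, pi1Map_mk f e₀ δ⟩

variable {E X : PDigr.{u}} {p : E ⟶ X}

/-- An `l`-covering induces an injective homomorphism of `l`-fundamental groups. -/
theorem pi1Map_injective (h : Digr.IsCovering l p.hom) : Function.Injective (pi1Map l p) :=
  pi1Map_injective_aux p.map_pt h

/-- The image of `p_*` is the stabilizer of the basepoint. -/
theorem mem_range_pi1Map_iff (h : Digr.IsCovering l p.hom) (γ : ob l X.pt ⟶ ob l X.pt) :
    End.of γ ∈ (pi1Map l p).range ↔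
      mon h γ (⟨E.pt, p.map_pt⟩ : Fib p.hom X.pt) = ⟨E.pt, p.map_pt⟩ :=
  mem_range_pi1Map_iff_aux p.map_pt h γ

end LPi

/-! ### Morphisms between coverings. -/

namespace LPi

section

variable {l : ℕ} {E E' X : Digr.{u}} {p : E ⟶ X} {q : E' ⟶ X}

/-- A morphism of coverings commutes with the actions on the fibres. -/
theorem mon_map (h : Digr.IsCovering l p) (h' : Digr.IsCovering l q) (f : E ⟶ E')
    (hf : ∀ e, q.toFun (f.toFun e) = p.toFun e) {x y : X.V} (γ : ob l x ⟶ ob l y) (e : Fib p x) :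
    mon h' γ ⟨f.toFun e.1, (hf _).trans e.2⟩ =
      ⟨f.toFun (mon h γ e).1, (hf _).trans (mon h γ e).2⟩ := by
  induction γ using induction with
  | har hxy =>
    rw [mon_ar, mon_ar]
    exact transport_eq _ _ _ _ ((Digr.dist_map_le f _ _).trans (transport_dist h hxy e))
  | hcomp γ δ hγ hδ => rw [mon_comp, hγ, hδ, mon_comp]
  | hinv γ hγ =>
    have := hγ (mon h (Groupoid.inv γ) e)
    simp only [mon_mon_inv] at this
    rw [← this, mon_inv_mon]

theorem exists_mon_eq (hl : 1 ≤ l) (hE : E.Connected) (h : Digr.IsCovering l p) {x y : X.V}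
    (e : Fib p x) (e' : Fib p y) : ∃ γ : ob l x ⟶ ob l y, mon h γ e = e' := by
  obtain ⟨e, rfl⟩ := e
  obtain ⟨e', rfl⟩ := e'
  obtain ⟨γ⟩ := exists_hom hl hE e e'
  exact ⟨push p γ, mon_push h γ⟩

/-- Lifting criterion for morphisms of coverings. -/
theorem exists_map (hl : 1 ≤ l) (hE : E.Connected) (h' : Digr.IsCovering l q) (e₀ : E.V)
    (b : Fib q (p.toFun e₀)) (hb : ∀ δ : ob l e₀ ⟶ ob l e₀, mon h' (push p δ) b = b) :
    ∃ f : E ⟶ E', f.toFun e₀ = b.1 ∧ f ≫ q = p := by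
  -- Two morphisms from `e₀` to `e` differ by a loop at `e₀`, whose image fixes `b`.
  have indep {e : E.V} (g g' : ob l e₀ ⟶ ob l e) :
      mon h' (push p g) b = mon h' (push p g') b := by
    have h1 := congrArg (mon h' (push p g')) (hb (g ≫ Groupoid.inv g'))
    rwa [← mon_comp, ← push_comp, Category.assoc, Groupoid.inv_comp, Category.comp_id] at h1
  let g (e : E.V) : ob l e₀ ⟶ ob l e := (exists_hom hl hE e₀ e).some
  refine ⟨⟨fun e => (mon h' (push p (g e)) b).1, fun {e e'} hee => ?_⟩, ?_, ?_⟩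
  · have h1 := indep (g e ≫ ar (hee.dist_le hl)) (g e')
    rw [push_comp, push_ar, mon_comp, mon_ar] at h1
    have h2 := transport_dist h' ((Digr.dist_map_le p e e').trans (hee.dist_le hl))
      (mon h' (push p (g e)) b)
    rw [h1] at h2
    -- The images are at distance at most `l`, so their distance equals that of their projections,
    -- which is at most `1`.
    rw [← Digr.dist_le_one_iff, h'.dist_eq h2, (mon h' (push p (g e)) b).2,
      (mon h' (push p (g e')) b).2]
    exact X.dist_le_one_iff.2 (p.map_E1 hee)
  · exact congrArg Subtype.val (hb (g e₀))
  · exact Digr.Hom.ext (funext fun e => (mon h' (push p (g e)) b).2)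

/-- Two morphisms over `X` from a connected digraph to an `l`-covering of `X` that agree at a
vertex are equal. -/
theorem map_unique (hl : 1 ≤ l) (hE : E.Connected) (h' : Digr.IsCovering l q) (f f' : E ⟶ E')
    (hf : f ≫ q = f' ≫ q) (e₀ : E.V) (h0 : f.toFun e₀ = f'.toFun e₀) : f = f' := by
  have hq (e : E.V) : q.toFun (f.toFun e) = q.toFun (f'.toFun e) :=
    congrFun (congrArg Digr.Hom.toFun hf) e
  refine Digr.Hom.ext (funext fun e => ?_)
  -- Agreement at one vertex need not be assumed here: the relation is that agreement at `x` and at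
  -- `y` are equivalent.
  refine (hE.induction (fun x y => f.toFun x = f'.toFun x ↔ f.toFun y = f'.toFun y)
    ⟨fun _ => Iff.rfl, Iff.symm, Iff.trans⟩ (fun x y hxy => ?_) e₀ e).1 h0
  have h1 := (f.map_E1 hxy).dist_le hl
  have h2 := (f'.map_E1 hxy).dist_le hl
  constructor
  · intro hx
    rw [← hx] at h2
    exact (h'.existsUnique_head (f.toFun x) _ ((Digr.dist_map_le q _ _).trans h1)).unique
      ⟨rfl, h1⟩ ⟨(hq y).symm, h2⟩
  · intro hy
    rw [← hy] at h2
    exact (h'.existsUnique_tail (f.toFun y) _ ((Digr.dist_map_le q _ _).trans h1)).unique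
      ⟨rfl, h1⟩ ⟨(hq x).symm, h2⟩

theorem mon_push_eq_of_range_le {x₀ : X.V} {e₀ : E.V} {b₀ : E'.V} (hp : p.toFun e₀ = x₀)
    (hq : q.toFun b₀ = x₀) (h' : Digr.IsCovering l q)
    (hle : (pi1Map l (E := ⟨E, e₀⟩) (X := ⟨X, x₀⟩) ⟨p, hp⟩).range ≤
      (pi1Map l (E := ⟨E', b₀⟩) (X := ⟨X, x₀⟩) ⟨q, hq⟩).range) (δ : ob l e₀ ⟶ ob l e₀) :
    mon h' (push p δ) ⟨b₀, hq.trans hp.symm⟩ = ⟨b₀, hq.trans hp.symm⟩ := by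
  subst hp
  exact (mem_range_pi1Map_iff_aux hq h' _).1 (hle ⟨End.of δ, pi1Map_mk p e₀ δ⟩)

end

end LPi

/-! ### The equivalence of categories and the fibre. -/

namespace ConnCov

open LPi

variable {l : ℕ} {X : PDigr.{u}}

/-- A pointed equivariant map sends the stabilizer of the base vertex into that of its image. -/
theorem range_le_of_hom {p q : ConnCov l X} (f : p ⟶ q) :
    (pi1Map l p.proj).range ≤ (pi1Map l q.proj).range := by
  intro γ hγ
  have h1 := (mem_range_pi1Map_iff p.isCovering γ.asHom).1 hγ
  refine (mem_range_pi1Map_iff q.isCovering γ.asHom).2 ?_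
  have hw : ∀ e, q.proj.hom.toFun (f.hom.left.hom.toFun e) = p.proj.hom.toFun e := fun e =>
    congrArg (fun g : p.total ⟶ X => g.hom.toFun e) (Over.w f.hom)
  have h2 := mon_map p.isCovering q.isCovering f.hom.left.hom hw γ.asHom
    ⟨p.total.pt, p.proj.map_pt⟩
  rw [h1] at h2
  have h3 : f.hom.left.hom.toFun p.total.pt = q.total.pt := f.hom.left.map_pt
  simpa only [h3] using h2

/-- The functor that sends a covering to the image of `p_*`. -/
def rangeFunctor (l : ℕ) (X : PDigr.{u}) : ConnCov l X ⥤ Subgroup (pi1 l X) where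
  obj p := (pi1Map l p.proj).range
  map f := homOfLE (range_le_of_hom f)

theorem exists_hom_of_range_le (hl : 1 ≤ l) {p q : ConnCov l X}
    (hle : (pi1Map l p.proj).range ≤ (pi1Map l q.proj).range) : Nonempty (p ⟶ q) := by
  obtain ⟨f, hf, hfq⟩ := exists_map hl p.property.2 q.isCovering p.total.pt _
    (mon_push_eq_of_range_le p.proj.map_pt q.proj.map_pt q.isCovering hle)
  exact ⟨ObjectProperty.homMk (Over.homMk ⟨f, hf⟩ (PDigr.Hom.ext hfq))⟩

theorem hom_subsingleton (hl : 1 ≤ l) {p q : ConnCov l X} (f g : p ⟶ q) : f = g := by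
  apply ObjectProperty.hom_ext
  apply Over.OverMorphism.ext
  apply PDigr.Hom.ext
  refine map_unique hl p.property.2 q.isCovering _ _ ?_ p.total.pt
    (f.hom.left.map_pt.trans g.hom.left.map_pt.symm)
  exact congrArg PDigr.Hom.hom ((Over.w f.hom).trans (Over.w g.hom).symm)

/-- Monodromy is translation here, and `γ` fixes the class of the identity exactly when `γ` lies in
`H`. -/
theorem range_cover (H : Subgroup (pi1 l X)) :
    (pi1Map l (SubgroupCover.cover H).proj).range = H := by
  ext γ
  refine (mem_range_pi1Map_iff SubgroupCover.isCovering_proj γ.asHom).trans ?_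
  have h1 := SubgroupCover.mon_proj (H := H) γ.asHom (SubgroupCover.Coset.mk (𝟙 _))
  refine (Eq.congr_left h1).trans ?_
  rw [SubgroupCover.translate_mk, Category.id_comp]
  constructor
  · intro h
    have h2 : (⟨X.pt, SubgroupCover.Coset.mk γ.asHom⟩ : Σ x, SubgroupCover.Coset H x) =
        ⟨X.pt, SubgroupCover.Coset.mk (𝟙 _)⟩ := congrArg Subtype.val h
    obtain ⟨η, hη, h3⟩ := SubgroupCover.Coset.mk_eq_iff.1 (eq_of_heq (Sigma.mk.inj h2).2).symm
    rw [Category.comp_id] at h3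
    rwa [h3] at hη
  · intro h
    have h2 : (SubgroupCover.Coset.mk (𝟙 _) : SubgroupCover.Coset H X.pt) =
        SubgroupCover.Coset.mk γ.asHom :=
      SubgroupCover.Coset.mk_eq_iff.2 ⟨γ.asHom, h, Category.comp_id _⟩
    rw [← h2]
    rfl

theorem rangeFunctor_isEquivalence (hl : 1 ≤ l) : (rangeFunctor l X).IsEquivalence where
  faithful := ⟨fun _ => hom_subsingleton hl _ _⟩
  full := ⟨fun f => ⟨(exists_hom_of_range_le hl (leOfHom f)).some, Subsingleton.elim _ _⟩⟩
  essSurj := ⟨fun H => ⟨SubgroupCover.cover H, ⟨eqToIso (range_cover H)⟩⟩⟩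

/-- The cosets agree when `δ * γ⁻¹` fixes the base vertex; since `γ⁻¹` takes that vertex to `e`,
this says that `δ` sends `e` where it sends `e'`. -/
theorem rightCosets_mk_eq_iff (p : ConnCov l X) {e e' : Fib p.proj.hom X.pt}
    {γ δ : ob l X.pt ⟶ ob l X.pt}
    (hγ : mon p.isCovering γ e = ⟨p.total.pt, p.proj.map_pt⟩)
    (hδ : mon p.isCovering δ e' = ⟨p.total.pt, p.proj.map_pt⟩) :
    RightCosets.mk (pi1Map l p.proj).range (End.of γ) = RightCosets.mk _ (End.of δ) ↔ e = e' := by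
  refine (_root_.Quotient.eq (r := QuotientGroup.rightRel (pi1Map l p.proj).range)).trans ?_
  rw [QuotientGroup.rightRel_apply]
  refine (mem_range_pi1Map_iff p.isCovering (Groupoid.inv γ ≫ δ)).trans ?_
  rw [mon_comp, ← hγ, mon_inv_mon, hγ, ← hδ]
  constructor
  · intro h
    rw [← mon_inv_mon p.isCovering δ e, h, mon_inv_mon]
  · rintro rfl
    rfl

theorem exists_fiber_equiv (hl : 1 ≤ l) (p : ConnCov l X) :
    ∃ φ : p.Fiber →[(pi1 l X)ᵐᵒᵖ] RightCosets (pi1Map l p.proj).range,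
      Function.Bijective φ := by
  -- A vertex `e` is sent to the coset of any loop carrying `e` to the base vertex.
  choose g hg using fun e : Fib p.proj.hom X.pt => exists_mon_eq hl p.property.2 p.isCovering e
    (⟨p.total.pt, p.proj.map_pt⟩ : Fib p.proj.hom X.pt)
  have hsmul (k : (pi1 l X)ᵐᵒᵖ) (e : p.Fiber) :
      (k • e : p.Fiber) = mon p.isCovering (Groupoid.inv k.unop.asHom) e := by
    have h1 : mon p.isCovering k.unop.asHom (k • e : p.Fiber) = e :=
      ConcreteCategory.congr_hom ((monodromy p.isCovering).map k.unop.asHom).iso.inv_hom_id e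
    exact (mon_inv_mon p.isCovering k.unop.asHom _).symm.trans
      (congrArg (mon p.isCovering (Groupoid.inv k.unop.asHom)) h1)
  refine ⟨⟨fun e => RightCosets.mk _ (End.of (g e)), fun k e => ?_⟩, ?_, ?_⟩
  · change Fib p.proj.hom X.pt at e
    -- The composite `k` followed by `g e` is the product `g e * k`, and it carries `e · k` to the
    -- base vertex.
    refine (rightCosets_mk_eq_iff p (hg _) (e' := k • (show p.Fiber from e))
      (δ := k.unop.asHom ≫ g e) ?_).2 rfl
    rw [hsmul, mon_comp, mon_mon_inv, hg]
  · intro e e' hee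
    exact (rightCosets_mk_eq_iff p (hg e) (hg e')).1 hee
  · intro c
    obtain ⟨γ, rfl⟩ := Quot.mk_surjective c
    refine ⟨mon p.isCovering (Groupoid.inv γ.asHom) ⟨p.total.pt, p.proj.map_pt⟩, ?_⟩
    exact (rightCosets_mk_eq_iff p (hg _) (δ := γ.asHom) (mon_mon_inv _ _ _)).2 rfl

end ConnCov

end

end LCover

theorem theorem3p11 (l : ℕ) (hl : 1 ≤ l) (X : LCover.PDigr.{u}) (hX : X.X.Connected) :
    (∃ F : LCover.ConnCov l X ≌ Subgroup (LCover.pi1 l X),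
      ∀ p : LCover.ConnCov l X, F.functor.obj p = (LCover.pi1Map l p.proj).range) ∧
    ∀ p : LCover.ConnCov l X,
      Function.Injective (LCover.pi1Map l p.proj) ∧
      ∃ φ : p.Fiber →[(LCover.pi1 l X)ᵐᵒᵖ] LCover.RightCosets (LCover.pi1Map l p.proj).range,
        Function.Bijective φ := by
  have := LCover.ConnCov.rangeFunctor_isEquivalence (X := X) hl
  exact ⟨⟨(LCover.ConnCov.rangeFunctor l X).asEquivalence, fun _ => rfl⟩,
    fun p => ⟨LCover.LPi.pi1Map_injective p.isCovering, LCover.ConnCov.exists_fiber_equiv hl p⟩⟩
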